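/- Let $D\subset\mathbb C^n$ be a domain and $\delta_D(z)=\operatorname{dist}(z,\partial D)$. For $z\in D$ at which $\delta_D$ is differentiable and which has a unique closest point $\pi(z)\in\partial D$, and $X\in\mathbb C^n$, put $X_z=2\sum_j\frac{\partial\delta_D}{\partial z_j}(z)X_j=\langle X,n_{\pi(z)}\rangle$, the component of $X$ along the inner unit normal $n_{\pi(z)}$ to $\partial D$ at $\pi(z)$, where $\langle\cdot,\cdot\rangle$ is the Hermitian inner product. Put $$H_D(z,w)=\frac{|(z-w)_z|}{\sqrt{|(z-w)_z|}+|z-w|+\sqrt{\delta_D(z)}}+|z-w|.$$ Let $k_D$ be the Kobayashi pseudodistance of $D$, i.e. the largest pseudodistance not exceeding the Lempert function $$l_D(z,w)=\inf\{\tanh^{-1}|\alpha|:\ \exists\,\varphi:\mathbb D\to D \text{ holomorphic},\ \varphi(0)=z,\ \varphi(\alpha)=w\}.$$ Let $p\in\partial D$ be a $\mathcal C^2$-smooth non-semipositive boundary point: $D$ is given near $p$ by $\{s<0\}$ with $s$ of class $\mathcal C^2$ and $ds(p)\neq0$, and the Levi form satisfies $\partial\overline\partial s(X,\overline X)(p)<0$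 for some $X$ in the complex tangent space $T^{\mathbb C}_p(\partial D)$. Then there is a neighborhood $U$ of $p$ such that every $z\in D\cap U$ has a unique closest point in $\partial D$ and $\delta_D$ is differentiable at $z$, and the following hold. 1. There is a constant $C>0$ such that $k_D(z,w)\le C\,H_D(z,w)$ for all $z,w\in D\cap U$. 2. If moreover $D$ is bounded, there is a constant $c>0$ such that $c\,H_D(z,w)\le k_D(z,w)$ for all $z,w\in D\cap U$; hence $k_D\asymp H_D$ on $D\cap U$. 3. There is a constant $C>0$ such that $k_D(z,w)\le C\left(\sqrt{|(z-w)_z|}+|z-w|\right)$ for all $z,w\in D\cap U$. -/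

import Mathlib

open scoped ENNReal Topology

noncomputable section

/-- `ℂⁿ` with its Euclidean norm. -/
abbrev Cn (n : ℕ) : Type := EuclideanSpace ℂ (Fin n)

/-- The Lempert function
`l_D(z,w) = inf {artanh |α| : φ ∈ 𝓞(𝔻, D), φ(0) = z, φ(α) = w, α ∈ 𝔻}`,
with values in `[0,∞]` (it is `∞` if there is no such disc). -/
def lempert {n : ℕ} (D : Set (Cn n)) (z w : Cn n) : ℝ≥0∞ :=
  sInf {t | ∃ (φ : ℂ → Cn n) (α : ℂ), DifferentiableOn ℂ φ (Metric.ball 0 1) ∧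
    Set.MapsTo φ (Metric.ball 0 1) D ∧ α ∈ Metric.ball (0 : ℂ) 1 ∧
    φ 0 = z ∧ φ α = w ∧ t = ENNReal.ofReal (Real.artanh ‖α‖)}

/-- `d` is an (extended) pseudodistance on `D`. -/
structure IsPseudoDistOn {n : ℕ} (D : Set (Cn n)) (d : Cn n → Cn n → ℝ≥0∞) : Prop where
  refl : ∀ z ∈ D, d z z = 0
  symm : ∀ z ∈ D, ∀ w ∈ D, d z w = d w z
  triangle : ∀ x ∈ D, ∀ y ∈ D, ∀ z ∈ D, d x z ≤ d x y + d y z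

/-- The Kobayashi pseudodistance `k_D`: the largest pseudodistance on `D` not exceeding `l_D`
(the pointwise supremum of such pseudodistances is again one). Only meaningful on `D × D`. -/
def kobayashi {n : ℕ} (D : Set (Cn n)) (z w : Cn n) : ℝ≥0∞ :=
  ⨆ (d : Cn n → Cn n → ℝ≥0∞) (_ : IsPseudoDistOn D d)
    (_ : ∀ x ∈ D, ∀ y ∈ D, d x y ≤ lempert D x y), d z w

/-- `δ_D(z)`, the Euclidean distance to the boundary. -/
def bdist {n : ℕ} (D : Set (Cn n)) (z : Cn n) : ℝ :=
  Metric.infDist z (frontier D)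

/-- The component `X_z = ⟨X, ∇δ_D(z)⟩ = 2 ∑ⱼ (∂δ_D/∂zⱼ)(z) Xⱼ` of `X` along the complex normal.
Here `∇` is the real gradient, equal to `2 ∂̄δ_D(z)`; it is the inner unit normal to `∂D` at the
point of `∂D` closest to `z`. (Mathlib's `inner` is conjugate linear in its first argument.) -/
def normalComp {n : ℕ} (D : Set (Cn n)) (z X : Cn n) : ℂ :=
  inner ℂ (gradient (bdist D) z) X

/-- `H_D(z,w)`. -/
def HD {n : ℕ} (D : Set (Cn n)) (z w : Cn n) : ℝ :=
  ‖normalComp D z (z - w)‖ /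
    (√‖normalComp D z (z - w)‖ + ‖z - w‖ + √(bdist D z)) + ‖z - w‖

/-- `s` is a `C²` local defining function of `D` at `p`. -/
structure IsC2DefiningAt {n : ℕ} (D : Set (Cn n)) (p : Cn n) (s : Cn n → ℝ) : Prop where
  contDiffAt : ContDiffAt ℝ 2 s p
  fderiv_ne : fderiv ℝ s p ≠ 0
  mem_iff : ∀ᶠ z in 𝓝 p, z ∈ D ↔ s z < 0

/-- The Levi form `∂∂̄s(X, X̄)(p) = ∑ (∂²s/∂zⱼ∂z̄ₖ)(p) Xⱼ X̄ₖ`, written through the real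
second derivative: it equals `(s''(p)[X,X] + s''(p)[iX,iX]) / 4`. -/
def leviForm {n : ℕ} (s : Cn n → ℝ) (p X : Cn n) : ℝ :=
  (fderiv ℝ (fderiv ℝ s) p X X +
    fderiv ℝ (fderiv ℝ s) p (Complex.I • X) (Complex.I • X)) / 4

/-- `p` is a `C²`-smooth non-semipositive boundary point of `D`: the Levi form of a defining
function is negative at some `X` in the complex tangent space `T_p ∂D ∩ i T_p ∂D`. -/
def NonSemipositive {n : ℕ} (D : Set (Cn n)) (p : Cn n) : Prop :=
  p ∈ frontier D ∧ ∃ s : Cn n → ℝ, IsC2DefiningAt D p s ∧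
    ∃ X : Cn n, fderiv ℝ s p X = 0 ∧ fderiv ℝ s p (Complex.I • X) = 0 ∧ leviForm s p X < 0

end

/-! ### Bounding the Kobayashi pseudodistance from above by discs and from below by functions. -/

section KobayashiBasics

variable {n : ℕ} {D : Set (Cn n)}

/-! Write A for |(z-w)_z|, t for |z-w| and δ for the boundary distance of z.

Upper bound. The Levi form is negative in a complex tangent direction, and a holomorphic second
order correction cancels the non-Hermitian part of the Taylor polynomial. So through every z near p
passes a quadratic disc of fixed radius along which s drops by c|ζ|² (`exists_disc_estimate`). Its
direction may be tilted by a small V whose normal component is O(√δ): the linear gain is then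
absorbed by the depth and the quadratic drop. A tilted disc at z and an untilted one at w can be
given a common end point at a parameter τ of order t + A/√δ, which bounds k_D by a multiple of τ
(`DiscField.exists_kobayashi_le`). If √δ dominates √A + t, this τ is comparable to H_D. Otherwise
both points are first pushed along untilted discs to depth of order η², with η a multiple of √A + t;
each move costs O(η), and H_D is itself comparable to √A + t.

Lower bound. This rests on boundedness and C² smoothness. For fixed z, the truncation of H_D(z,·) is
Lipschitz at the centre of every analytic disc φ in D, with a uniform constant, and such functions
minorize k_D (`abs_sub_le_kobayashi`). Boundedness gives |φ(ζ) - φ(0)| ≤ M|ζ|. Near the closest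
point q of z the domain lies outside a paraboloid, so the normal component of φ has real part at
least -O(σ²) on a disc of radius of order σ = √A + t + √δ, now with φ(0) in place of w.
Borel–Carathéodory then bounds its rate of change by O(σ) (`LocalDefining.norm_herm_disc_sub_le`),
and σ is exactly the denominator in H_D. -/

theorem kobayashi_le_lempert {z w : Cn n} (hz : z ∈ D) (hw : w ∈ D) :
    kobayashi D z w ≤ lempert D z w :=
  iSup_le fun _ => iSup_le fun _ => iSup_le fun h => h z hz w hw

theorem kobayashi_self {z : Cn n} (hz : z ∈ D) : kobayashi D z z = 0 :=
  le_antisymm (iSup_le fun _ => iSup_le fun hd => iSup_le fun _ => (hd.refl z hz).le) zero_le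

theorem kobayashi_symm_le {z w : Cn n} (hz : z ∈ D) (hw : w ∈ D) :
    kobayashi D z w ≤ kobayashi D w z := by
  refine iSup_le fun d => iSup_le fun hd => iSup_le fun h => ?_
  rw [hd.symm z hz w hw]
  exact le_iSup_of_le d (le_iSup_of_le hd (le_iSup_of_le h le_rfl))

theorem kobayashi_triangle {x y z : Cn n} (hx : x ∈ D) (hy : y ∈ D) (hz : z ∈ D) :
    kobayashi D x z ≤ kobayashi D x y + kobayashi D y z := by
  refine iSup_le fun d => iSup_le fun hd => iSup_le fun h => ?_
  refine (hd.triangle x hx y hy z hz).trans (add_le_add ?_ ?_) <;>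
  exact le_iSup_of_le d (le_iSup_of_le hd (le_iSup_of_le h le_rfl))

theorem artanh_le_two_mul {t : ℝ} (h0 : 0 ≤ t) (h1 : t ≤ 1 / 2) : Real.artanh t ≤ 2 * t := by
  rw [Real.artanh_eq_half_log ⟨by linarith, by linarith⟩]
  have h := Real.log_le_sub_one_of_pos (x := (1 + t) / (1 - t)) (by
    apply div_pos <;> linarith)
  have h2 : (1 + t) / (1 - t) - 1 ≤ 4 * t := by
    rw [sub_le_iff_le_add, div_le_iff₀ (by linarith)]
    nlinarith
  linarith

theorem neg_log_one_sub_le_two_mul_artanh {t : ℝ} (h0 : 0 ≤ t) (h1 : t < 1) :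
    -Real.log (1 - t) ≤ 2 * Real.artanh t := by
  rw [Real.artanh_eq_half_log ⟨by linarith, by linarith⟩, Real.log_div (by linarith) (by linarith)]
  have := Real.log_nonneg (x := 1 + t) (by linarith)
  linarith

/-- A point of a disc of radius `ρ` at parameter `τ ≤ ρ / 2` is at Kobayashi distance at most
`2 τ / ρ` from the centre. -/
theorem kobayashi_le_of_disc {ψ : ℂ → Cn n} {ρ τ : ℝ} (hρ : 0 < ρ)
    (hψ : DifferentiableOn ℂ ψ (Metric.ball 0 ρ)) (hD : Set.MapsTo ψ (Metric.ball 0 ρ) D)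
    (hτ : 0 ≤ τ) (hτρ : τ ≤ ρ / 2) :
    kobayashi D (ψ 0) (ψ τ) ≤ ENNReal.ofReal (2 * τ / ρ) := by
  have hball : Set.MapsTo (fun ζ : ℂ => (ρ : ℂ) * ζ) (Metric.ball 0 1) (Metric.ball 0 ρ) := by
    intro ζ hζ
    simp only [Metric.mem_ball, dist_zero_right, norm_mul, Complex.norm_real,
      Real.norm_eq_abs, abs_of_pos hρ] at hζ ⊢
    nlinarith
  have h0 : ψ 0 ∈ D := hD (Metric.mem_ball_self hρ)
  have h1 : ψ τ ∈ D := hD (by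
    simp only [Metric.mem_ball, dist_zero_right, Complex.norm_real, Real.norm_eq_abs,
      abs_of_nonneg hτ]
    linarith)
  have hd : 0 ≤ τ / ρ := by positivity
  have hd2 : τ / ρ ≤ 1 / 2 := by rw [div_le_iff₀ hρ]; linarith
  have hn : ‖((τ / ρ : ℝ) : ℂ)‖ = τ / ρ := by
    rw [Complex.norm_real, Real.norm_eq_abs, abs_of_nonneg hd]
  refine (kobayashi_le_lempert h0 h1).trans ?_
  have hle : lempert D (ψ 0) (ψ τ) ≤ ENNReal.ofReal (Real.artanh ‖((τ / ρ : ℝ) : ℂ)‖) := by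
    refine sInf_le ⟨fun ζ => ψ (ρ * ζ), ((τ / ρ : ℝ) : ℂ),
      hψ.comp (by fun_prop) hball, hD.comp hball, ?_, by simp, ?_, rfl⟩
    · rw [mem_ball_zero_iff, hn]; linarith
    · have : (ρ : ℂ) ≠ 0 := by exact_mod_cast hρ.ne'
      simp only [Complex.ofReal_div]
      rw [mul_div_cancel₀ _ this]
  refine hle.trans ?_
  rw [hn]
  exact ENNReal.ofReal_le_ofReal ((artanh_le_two_mul hd hd2).trans (le_of_eq (by ring)))

/-- A function whose composition with every analytic disc in `D` is `K`-Lipschitz at the centre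
yields a lower bound for the Kobayashi pseudodistance. -/
theorem abs_sub_le_kobayashi {f : Cn n → ℝ} {K : ℝ} (hK : 0 < K)
    (hf : ∀ φ : ℂ → Cn n, DifferentiableOn ℂ φ (Metric.ball 0 1) →
      Set.MapsTo φ (Metric.ball 0 1) D → ∀ᶠ ζ in 𝓝 (0 : ℂ), |f (φ ζ) - f (φ 0)| ≤ K * ‖ζ‖)
    (z w : Cn n) :
    ENNReal.ofReal (|f z - f w| / (2 * K)) ≤ kobayashi D z w := by
  have hpd : IsPseudoDistOn D (fun z w => ENNReal.ofReal (|f z - f w| / (2 * K))) := by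
    refine ⟨fun z _ => by simp, fun z _ w _ => by rw [abs_sub_comm], fun x _ y _ z _ => ?_⟩
    rw [← ENNReal.ofReal_add (by positivity) (by positivity), ← add_div]
    refine ENNReal.ofReal_le_ofReal ?_
    gcongr
    exact abs_sub_le _ _ _
  refine le_iSup_of_le _ (le_iSup_of_le hpd (le_iSup_of_le ?_ le_rfl))
  rintro x - y -
  refine le_sInf ?_
  rintro t ⟨φ, α, hφ, hD, hα, rfl, rfl, rfl⟩
  refine ENNReal.ofReal_le_ofReal ?_
  rw [div_le_iff₀ (by positivity)]
  rw [mem_ball_zero_iff] at hα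
  rcases eq_or_ne α 0 with rfl | hα0
  · simp
  have ha : 0 < ‖α‖ := norm_pos_iff.2 hα0
  set e : ℂ := α / ‖α‖ with he
  have hac : (‖α‖ : ℂ) ≠ 0 := by exact_mod_cast ha.ne'
  have hen : ‖e‖ = 1 := by
    rw [he, norm_div, Complex.norm_real, norm_norm, div_self ha.ne']
  clear_value e
  -- The hypothesis concerns only centres of discs. Composing φ with ζ ↦ te + (1-t)ζ, a self-map of
  -- the unit disc, makes te a centre at the price of the factor 1/(1-t).
  have hloc : ∀ t : ℝ, 0 ≤ t → t < 1 → ∀ᶠ u : ℝ in 𝓝 t,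
      |f (φ (u * e)) - f (φ (t * e))| ≤ K * |u - t| / (1 - t) := by
    intro t ht0 ht1
    have h1t : 0 < 1 - t := by linarith
    have hte : ‖(t : ℂ) * e‖ = t := by
      rw [norm_mul, hen, Complex.norm_real, Real.norm_eq_abs, abs_of_nonneg ht0, mul_one]
    have hmaps : Set.MapsTo (fun ζ : ℂ => (t : ℂ) * e + ((1 - t : ℝ) : ℂ) * ζ)
        (Metric.ball 0 1) (Metric.ball 0 1) := by
      intro ζ hζ
      rw [mem_ball_zero_iff] at hζ ⊢
      refine (norm_add_le _ _).trans_lt ?_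
      rw [hte, norm_mul, Complex.norm_real, Real.norm_eq_abs, abs_of_pos h1t]
      nlinarith
    have key := hf (fun ζ => φ ((t : ℂ) * e + ((1 - t : ℝ) : ℂ) * ζ))
      (hφ.comp (by fun_prop) hmaps) (hD.comp hmaps)
    have htend : Filter.Tendsto (fun u : ℝ => (((u - t) / (1 - t) : ℝ) : ℂ) * e) (𝓝 t) (𝓝 0) := by
      have : Continuous (fun u : ℝ => (((u - t) / (1 - t) : ℝ) : ℂ) * e) := by fun_prop
      simpa using this.tendsto t
    filter_upwards [htend.eventually key] with u hu
    have hc : ((1 - t : ℝ) : ℂ) ≠ 0 := by exact_mod_cast h1t.ne'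
    have h3 : (t : ℂ) * e + ((1 - t : ℝ) : ℂ) * ((((u - t) / (1 - t) : ℝ) : ℂ) * e) = u * e := by
      rw [Complex.ofReal_div, ← mul_assoc, mul_div_cancel₀ _ hc]
      push_cast; ring
    rw [h3, mul_zero, add_zero, norm_mul, hen, Complex.norm_real, Real.norm_eq_abs, abs_div,
      abs_of_pos h1t, mul_one, ← mul_div_assoc] at hu
    exact hu
  set u : ℝ → ℝ := fun t => |f (φ (t * e)) - f (φ 0)| with hu
  have huloc : ∀ t : ℝ, 0 ≤ t → t < 1 → ∀ᶠ v : ℝ in 𝓝 t, |u v - u t| ≤ K * |v - t| / (1 - t) := by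
    intro t h0 h1
    filter_upwards [hloc t h0 h1] with v hv
    refine le_trans ?_ hv
    refine (abs_abs_sub_abs_le _ _).trans (le_of_eq ?_)
    congr 1; ring
  have hcont : ContinuousOn u (Set.Icc 0 ‖α‖) := by
    intro t ht
    refine ContinuousAt.continuousWithinAt ?_
    have ht1 : t < 1 := ht.2.trans_lt hα
    rw [ContinuousAt, tendsto_iff_dist_tendsto_zero]
    refine squeeze_zero' (Filter.Eventually.of_forall fun _ => dist_nonneg)
      (huloc t ht.1 ht1) ?_
    have : Continuous fun v : ℝ => K * |v - t| / (1 - t) := by fun_prop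
    simpa using this.tendsto t
  -- The local bounds integrate to -K log(1-t), the primitive of K/(1-t). This is at most 2K artanh
  -- t, whence the factor 2K in the statement.
  have hfin := image_le_of_liminf_slope_right_le_deriv_boundary hcont
    (B := fun t => -(K * Real.log (1 - t))) (B' := fun t => K / (1 - t)) (by simp [hu])
    (by
      refine ContinuousOn.neg (ContinuousOn.mul continuousOn_const
        (ContinuousOn.log (by fun_prop) ?_))
      intro t ht; linarith [ht.2])
    (by
      intro t ht
      refine HasDerivAt.hasDerivWithinAt ?_
      have h1 : (1 - t) ≠ 0 := by linarith [ht.2]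
      have := ((((hasDerivAt_id t).const_sub 1).log h1).const_mul K).neg
      refine this.congr_deriv ?_
      simp [div_eq_mul_inv])
    (by
      intro t ht r hr
      have ht1 : t < 1 := ht.2.trans hα
      refine Filter.Eventually.frequently ?_
      have h2 := (huloc t ht.1 ht1).filter_mono (nhdsWithin_le_nhds (s := Set.Ioi t))
      filter_upwards [h2, self_mem_nhdsWithin] with v hv hvt
      have hvt' : 0 < v - t := sub_pos.2 hvt
      refine lt_of_le_of_lt ?_ hr
      rw [slope_def_field, div_le_iff₀ hvt']
      rw [abs_of_pos hvt'] at hv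
      refine (le_abs_self _).trans (hv.trans (le_of_eq (by ring))))
    (Set.right_mem_Icc.2 ha.le)
  have hfin' : u ‖α‖ ≤ -(K * Real.log (1 - ‖α‖)) := hfin
  have hue : u ‖α‖ = |f (φ 0) - f (φ α)| := by
    rw [hu]; simp only [he]
    rw [mul_div_cancel₀ _ hac, abs_sub_comm]
  rw [← hue]
  have := mul_le_mul_of_nonneg_left (neg_log_one_sub_le_two_mul_artanh ha.le hα) hK.le
  linarith

end KobayashiBasics

/-! ### Algebra of the Hermitian form. -/

section Hermitian

variable {n : ℕ}

/-- The Hermitian form on `ℂⁿ`, linear in its second argument. -/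
noncomputable def herm (a x : Cn n) : ℂ := innerSL ℂ a x

theorem herm_add (a x y : Cn n) : herm a (x + y) = herm a x + herm a y := map_add _ _ _

theorem herm_sub (a x y : Cn n) : herm a (x - y) = herm a x - herm a y := map_sub _ _ _

theorem herm_neg (a x : Cn n) : herm a (-x) = -herm a x := map_neg _ _

theorem herm_smul (a x : Cn n) (c : ℂ) : herm a (c • x) = c * herm a x := by simp [herm]

theorem herm_real_smul (a x : Cn n) (t : ℝ) : herm a (t • x) = t * herm a x := by
  rw [← Complex.coe_smul, herm_smul]

theorem herm_sub_left (a b x : Cn n) : herm (a - b) x = herm a x - herm b x := by simp [herm]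

theorem herm_neg_left (a x : Cn n) : herm (-a) x = -herm a x := by simp [herm]

theorem herm_real_smul_left (a x : Cn n) (t : ℝ) : herm (t • a) x = t * herm a x := by
  rw [← Complex.coe_smul, herm, map_smulₛₗ, Complex.conj_ofReal]; rfl

theorem norm_herm_le (a x : Cn n) : ‖herm a x‖ ≤ ‖a‖ * ‖x‖ := norm_inner_le_norm a x

theorem abs_herm_re_le (a x : Cn n) : |(herm a x).re| ≤ ‖a‖ * ‖x‖ :=
  (Complex.abs_re_le_norm _).trans (norm_herm_le a x)

theorem herm_self (a : Cn n) : herm a a = (‖a‖ : ℂ) ^ 2 :=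
  inner_self_eq_norm_sq_to_K (𝕜 := ℂ) a

theorem herm_self_re (a : Cn n) : (herm a a).re = ‖a‖ ^ 2 := by
  rw [herm_self, ← Complex.ofReal_pow, Complex.ofReal_re]

theorem herm_re_comm (a x : Cn n) : (herm a x).re = (herm x a).re :=
  inner_re_symm (𝕜 := ℂ) a x

theorem norm_add_real_smul_sq (e a : Cn n) (t : ℝ) :
    ‖e + t • a‖ ^ 2 = ‖e‖ ^ 2 + 2 * t * (herm a e).re + t ^ 2 * ‖a‖ ^ 2 := by
  rw [← herm_self_re, ← herm_self_re, ← herm_self_re]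
  have : herm (e + t • a) (e + t • a) =
      herm e e + t * herm e a + (t * herm a e + t * (t * herm a a)) := by
    have h1 : ∀ x, herm (e + t • a) x = herm e x + t * herm a x := fun x => by
      rw [← herm_real_smul_left]; simp [herm]
    rw [h1, herm_add, herm_add, herm_real_smul, herm_real_smul]; ring
  rw [this]
  have h2 := herm_re_comm a e
  simp [h2]; ring

theorem continuous_herm : Continuous fun x : Cn n × Cn n => herm x.1 x.2 :=
  continuous_fst.inner continuous_snd

theorem inner_real_eq_herm_re (a x : Cn n) : inner ℝ a x = (herm a x).re := by
  simp [herm, PiLp.inner_apply, Complex.inner]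

theorem fderiv_eq_herm_re (s : Cn n → ℝ) (x v : Cn n) :
    fderiv ℝ s x v = (herm (gradient s x) v).re := by
  rw [← inner_real_eq_herm_re]; simp [gradient]

theorem normalComp_eq_herm (D : Set (Cn n)) (z v : Cn n) :
    normalComp D z v = herm (gradient (bdist D) z) v := rfl

end Hermitian

/-! ### Geometry of the boundary distance near a smooth boundary point. -/

/-- On the ball of radius `r` about `p`, the domain `D` is `{s < 0}`, where `s` has a first order
Taylor expansion with quadratic error and with a Lipschitz gradient `g` bounded away from `0`. -/
structure LocalDefining {n : ℕ} (D : Set (Cn n)) (p : Cn n) (s : Cn n → ℝ) (g : Cn n → Cn n)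
    (r L m : ℝ) : Prop where
  r_pos : 0 < r
  L_pos : 0 < L
  m_pos : 0 < m
  mem_iff : ∀ z ∈ Metric.ball p r, z ∈ D ↔ s z < 0
  taylor : ∀ z ∈ Metric.ball p r, ∀ x ∈ Metric.ball p r,
    |s x - s z - (herm (g z) (x - z)).re| ≤ L * ‖x - z‖ ^ 2
  lip : ∀ z ∈ Metric.ball p r, ∀ x ∈ Metric.ball p r, ‖g x - g z‖ ≤ L * ‖x - z‖
  lower : ∀ z ∈ Metric.ball p r, m ≤ ‖g z‖

/-- The unit vector in the direction of `a`. -/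
noncomputable def unitVec {n : ℕ} (a : Cn n) : Cn n := (‖a‖⁻¹ : ℝ) • a

theorem norm_unitVec {n : ℕ} {a : Cn n} (ha : 0 < ‖a‖) : ‖unitVec a‖ = 1 := by
  rw [unitVec, norm_smul, norm_inv, norm_norm, inv_mul_cancel₀ ha.ne']

theorem norm_smul_unitVec {n : ℕ} {a : Cn n} (ha : 0 < ‖a‖) : ‖a‖ • unitVec a = a := by
  rw [unitVec, smul_smul, mul_inv_cancel₀ ha.ne', one_smul]

theorem norm_unitVec_sub_le {n : ℕ} {a b : Cn n} {m : ℝ} (hm : 0 < m) (ha : m ≤ ‖a‖)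
    (hb : m ≤ ‖b‖) : ‖unitVec a - unitVec b‖ ≤ 2 / m * ‖a - b‖ := by
  have ha0 : 0 < ‖a‖ := hm.trans_le ha
  have hb0 : 0 < ‖b‖ := hm.trans_le hb
  have h : unitVec a - unitVec b = (‖a‖⁻¹ : ℝ) • ((a - b) - (‖a‖ - ‖b‖) • unitVec b) := by
    rw [sub_smul, norm_smul_unitVec hb0, smul_sub, smul_sub, smul_sub, smul_smul,
      inv_mul_cancel₀ ha0.ne', one_smul]
    unfold unitVec; abel
  rw [h, norm_smul, norm_inv, norm_norm]
  have h1 : ‖(a - b) - (‖a‖ - ‖b‖) • unitVec b‖ ≤ 2 * ‖a - b‖ := by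
    refine (norm_sub_le _ _).trans ?_
    rw [norm_smul, norm_unitVec hb0, Real.norm_eq_abs]
    linarith [abs_norm_sub_norm_le a b]
  have h2 : ‖a‖⁻¹ ≤ m⁻¹ := inv_anti₀ hm ha
  calc ‖a‖⁻¹ * _ ≤ m⁻¹ * (2 * ‖a - b‖) := by gcongr
    _ = _ := by ring

/-- A point of the complement closest to `z` lies on the frontier, so the complement is no nearer to
`z` than the frontier. -/
theorem ball_bdist_subset {n : ℕ} {D : Set (Cn n)} {z : Cn n} (hz : z ∈ D) :
    Metric.ball z (bdist D z) ⊆ D := by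
  by_cases hD : D = Set.univ
  · simp [hD]
  · obtain ⟨y, hy, hy'⟩ := exists_mem_frontier_infDist_compl_eq_dist hz hD
    refine (Metric.ball_subset_ball ?_).trans Metric.ball_infDist_compl_subset
    exact (Metric.infDist_le_dist_of_mem hy).trans_eq hy'.symm

namespace LocalDefining

variable {n : ℕ} {D : Set (Cn n)} {p : Cn n} {s : Cn n → ℝ} {g : Cn n → Cn n} {r L m : ℝ}

theorem continuousAt (h : LocalDefining D p s g r L m) {q : Cn n} (hq : q ∈ Metric.ball p r) :
    ContinuousAt s q := by
  rw [ContinuousAt, tendsto_iff_dist_tendsto_zero]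
  refine squeeze_zero' (g := fun x => ‖g q‖ * ‖x - q‖ + L * ‖x - q‖ ^ 2)
    (Filter.Eventually.of_forall fun _ => dist_nonneg) ?_ ?_
  · filter_upwards [Metric.isOpen_ball.mem_nhds hq] with x hx
    have h1 := h.taylor q hq x hx
    have h2 := abs_herm_re_le (g q) (x - q)
    rw [Real.dist_eq]
    rw [abs_le] at h1 h2 ⊢
    constructor <;> linarith
  · have : Continuous fun x => ‖g q‖ * ‖x - q‖ + L * ‖x - q‖ ^ 2 := by fun_prop
    simpa using this.tendsto q

theorem eq_zero_of_mem_frontier (h : LocalDefining D p s g r L m) {q : Cn n}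
    (hq : q ∈ Metric.ball p r) (hf : q ∈ frontier D) : s q = 0 := by
  have hb := Metric.isOpen_ball.mem_nhds hq
  rcases lt_trichotomy (s q) 0 with hs | hs | hs
  · refine absurd (mem_interior_iff_mem_nhds.2 ?_) hf.2
    filter_upwards [hb, (h.continuousAt hq).eventually (gt_mem_nhds hs)] with x hx hx'
    exact (h.mem_iff x hx).2 hx'
  · exact hs
  · obtain ⟨x, hx, hxD⟩ := mem_closure_iff_nhds.1 hf.1 _
      (Filter.inter_mem hb ((h.continuousAt hq).eventually (lt_mem_nhds hs)))
    exact absurd ((h.mem_iff x hx.1).1 hxD) (not_lt.2 (le_of_lt hx.2))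

theorem bdist_pos (hD : IsOpen D) {q z : Cn n} (hq : q ∈ frontier D) (hz : z ∈ D) :
    0 < bdist D z := by
  refine (isClosed_frontier.notMem_iff_infDist_pos ⟨q, hq⟩).1 fun hzf => ?_
  exact hzf.2 (hD.interior_eq.symm ▸ hz)

/-- A boundary point closest to `z` lies on the normal through `z`. -/
theorem eq_sub_unitVec (h : LocalDefining D p s g r L m) (hD : IsOpen D) {z q : Cn n}
    (hz : z ∈ D) (hq : q ∈ Metric.ball p r) (hf : q ∈ frontier D) (hd : dist z q = bdist D z) :
    z = q - bdist D z • unitVec (g q) := by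
  set δ := bdist D z with hδ
  have hδ0 : 0 < δ := bdist_pos hD hf hz
  have hG : 0 < ‖g q‖ := h.m_pos.trans_le (h.lower q hq)
  have hs0 := h.eq_zero_of_mem_frontier hq hf
  set e := z - q with he
  have hen : ‖e‖ = δ := by rw [← hd, dist_eq_norm]
  -- Such a v points from q into the ball about z of radius δ, which lies in D. Hence s(q + tv) < 0
  -- = s(q) for small t > 0.
  have key : ∀ v : Cn n, 0 < (herm e v).re → (herm (g q) v).re ≤ 0 := by
    intro v hv
    refine le_of_forall_pos_lt_add fun ε hε => ?_
    have hev : ∀ᶠ t : ℝ in 𝓝[>] 0, q + t • v ∈ Metric.ball p r ∧ L * t * ‖v‖ ^ 2 < ε ∧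
        t * ‖v‖ ^ 2 < 2 * (herm e v).re ∧ 0 < t := by
      have c1 : Continuous fun t : ℝ => q + t • v := by fun_prop
      have c2 : Continuous fun t : ℝ => L * t * ‖v‖ ^ 2 := by fun_prop
      have c3 : Continuous fun t : ℝ => t * ‖v‖ ^ 2 := by fun_prop
      have e1 := (c1.tendsto 0).eventually (Metric.isOpen_ball.mem_nhds (by simpa using hq))
      have e2 := (c2.tendsto 0).eventually_lt_const (u := ε) (by simpa using hε)
      have e3 := (c3.tendsto 0).eventually_lt_const
        (u := 2 * (herm e v).re) (by simpa using hv)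
      filter_upwards [nhdsWithin_le_nhds e1, nhdsWithin_le_nhds e2, nhdsWithin_le_nhds e3,
        self_mem_nhdsWithin] with t h1 h2 h3 h4
      exact ⟨h1, h2, h3, h4⟩
    obtain ⟨t, h1, h2, h3, h4⟩ := hev.exists
    have hin : q + t • v ∈ D := by
      refine ball_bdist_subset hz ?_
      rw [Metric.mem_ball, dist_comm, dist_eq_norm]
      have : z - (q + t • v) = e + (-t) • v := by rw [he, neg_smul]; abel
      rw [this]
      refine lt_of_pow_lt_pow_left₀ 2 hδ0.le ?_
      rw [norm_add_real_smul_sq, hen, herm_re_comm]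
      nlinarith
    have h5 := (h.mem_iff _ h1).1 hin
    have h6 := (abs_le.1 (h.taylor q hq _ h1)).1
    rw [add_sub_cancel_left, hs0, herm_real_smul, norm_smul, Complex.re_ofReal_mul,
      Real.norm_eq_abs, abs_of_pos h4] at h6
    have h7 : t * (herm (g q) v).re < t * (L * t * ‖v‖ ^ 2) := by nlinarith
    have := lt_of_mul_lt_mul_left h7 h4.le
    linarith
  -- This is the extremal case of Cauchy–Schwarz. It comes from testing `key` on ‖g q‖e + (1-κ')δ
  -- g(q), where κ' > 0 keeps the product with e strictly positive and is then made arbitrarily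
  -- small.
  have hge : (herm (g q) e).re + δ * ‖g q‖ ≤ 0 := by
    have hcs := (abs_le.1 (abs_herm_re_le (g q) e)).1
    rw [hen] at hcs
    refine le_of_forall_pos_le_add fun κ hκ => ?_
    set κ' := min 1 (κ / (δ * ‖g q‖)) with hκ'
    have k0 : 0 < κ' := lt_min one_pos (by positivity)
    have k1 : κ' ≤ 1 := min_le_left _ _
    have k2 : κ' * (δ * ‖g q‖) ≤ κ := by
      rw [← le_div_iff₀ (by positivity)]; exact min_le_right _ _
    have := key (‖g q‖ • e + ((1 - κ') * δ) • g q) (by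
      rw [herm_add, herm_real_smul, herm_real_smul, Complex.add_re, Complex.re_ofReal_mul,
        Complex.re_ofReal_mul, herm_self_re, hen, herm_re_comm e]
      have : (1 - κ') * δ * (herm (g q) e).re ≥ (1 - κ') * δ * (-(‖g q‖ * δ)) := by
        have : 0 ≤ (1 - κ') * δ := by nlinarith
        gcongr
      have : 0 < κ' * (‖g q‖ * δ ^ 2) := by positivity
      nlinarith)
    rw [herm_add, herm_real_smul, herm_real_smul, Complex.add_re, Complex.re_ofReal_mul,
        Complex.re_ofReal_mul, herm_self_re] at this
    have h8 : ‖g q‖ * ((herm (g q) e).re + (1 - κ') * δ * ‖g q‖) ≤ ‖g q‖ * 0 := by nlinarith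
    have := le_of_mul_le_mul_left h8 hG
    nlinarith
  have hzero : ‖e + (δ * ‖g q‖⁻¹) • g q‖ ^ 2 ≤ 0 := by
    rw [norm_add_real_smul_sq, hen]
    have : δ * ‖g q‖⁻¹ * (herm (g q) e).re ≤ δ * ‖g q‖⁻¹ * (-(δ * ‖g q‖)) := by
      gcongr; linarith
    have h9 : ‖g q‖⁻¹ * ‖g q‖ = 1 := inv_mul_cancel₀ hG.ne'
    have h10 : δ * ‖g q‖⁻¹ * (-(δ * ‖g q‖)) = -δ ^ 2 := by
      calc _ = -δ ^ 2 * (‖g q‖⁻¹ * ‖g q‖) := by ring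
        _ = _ := by rw [h9]; ring
    have h11 : (δ * ‖g q‖⁻¹) ^ 2 * ‖g q‖ ^ 2 = δ ^ 2 := by
      calc _ = δ ^ 2 * (‖g q‖⁻¹ * ‖g q‖) ^ 2 := by ring
        _ = _ := by rw [h9]; ring
    nlinarith
  have h0 : e + (δ * ‖g q‖⁻¹) • g q = 0 := by
    have := pow_eq_zero_iff (two_ne_zero) |>.1 (le_antisymm hzero (by positivity))
    exact norm_eq_zero.1 this
  rw [unitVec, smul_smul]
  rw [he] at h0
  have := eq_neg_of_add_eq_zero_left h0
  rw [sub_eq_iff_eq_add] at this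
  rw [this]; abel

theorem norm_unitVec_sub_le (h : LocalDefining D p s g r L m) {x y : Cn n}
    (hx : x ∈ Metric.ball p r) (hy : y ∈ Metric.ball p r) :
    ‖unitVec (g x) - unitVec (g y)‖ ≤ 2 * L / m * ‖x - y‖ := by
  refine (_root_.norm_unitVec_sub_le h.m_pos (h.lower x hx) (h.lower y hy)).trans ?_
  have := h.lip y hy x hx
  have hm := h.m_pos
  calc 2 / m * ‖g x - g y‖ ≤ 2 / m * (L * ‖x - y‖) := by gcongr
    _ = _ := by ring

theorem abs_unitVec_herm_re_le (h : LocalDefining D p s g r L m) {x y : Cn n}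
    (hx : x ∈ Metric.ball p r) (hy : y ∈ Metric.ball p r) (hsx : s x = 0) (hsy : s y = 0) :
    |(herm (unitVec (g x)) (y - x)).re| ≤ L / m * ‖y - x‖ ^ 2 := by
  have h1 := h.taylor x hx y hy
  rw [hsx, hsy, sub_zero, zero_sub, abs_neg] at h1
  have h2 := h.lower x hx
  have hm := h.m_pos
  have hL := h.L_pos
  rw [unitVec, herm_real_smul_left, Complex.re_ofReal_mul, abs_mul, abs_inv, abs_norm,
    inv_mul_eq_div, div_mul_eq_mul_div]
  gcongr

end LocalDefining

namespace LocalDefining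

variable {n : ℕ} {D : Set (Cn n)} {p : Cn n} {s : Cn n → ℝ} {g : Cn n → Cn n} {r L m ρ : ℝ}

theorem bdist_lt (hp : p ∈ frontier D) {z : Cn n} (hz : z ∈ Metric.ball p ρ) : bdist D z < ρ :=
  (Metric.infDist_le_dist_of_mem hp).trans_lt hz

theorem exists_nearest (hp : p ∈ frontier D) (z : Cn n) :
    ∃ q ∈ frontier D, dist z q = bdist D z := by
  obtain ⟨q, hq, hd⟩ := isClosed_frontier.exists_infDist_eq_dist ⟨p, hp⟩ z
  exact ⟨q, hq, hd.symm⟩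

theorem nearest_mem_ball (hp : p ∈ frontier D) (hρ : 2 * ρ ≤ r) {z q : Cn n}
    (hz : z ∈ Metric.ball p ρ) (hd : dist z q = bdist D z) : q ∈ Metric.ball p r := by
  have h1 := bdist_lt hp hz
  have h2 := dist_triangle q z p
  rw [dist_comm q z, hd] at h2
  rw [Metric.mem_ball] at hz ⊢
  linarith

/-- Subtract the normal equations of the two points. The boundary distance is 1-Lipschitz, and δ
times the Lipschitz constant 2L/m of the normal is at most 1/2. So ‖q'-q‖ ≤ 2‖w-z‖ + ‖q'-q‖/2.
Uniqueness of the closest point is the case w = z. -/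
theorem norm_nearest_sub_le (h : LocalDefining D p s g r L m) (hD : IsOpen D)
    (hp : p ∈ frontier D) (hρ : 2 * ρ ≤ r) (hρm : 4 * L * ρ ≤ m) {z w q q' : Cn n}
    (hz : z ∈ D) (hzp : z ∈ Metric.ball p ρ) (hw : w ∈ D) (hwp : w ∈ Metric.ball p ρ)
    (hq : q ∈ frontier D) (hq' : q' ∈ frontier D) (hd : dist z q = bdist D z)
    (hd' : dist w q' = bdist D w) : ‖q' - q‖ ≤ 4 * ‖w - z‖ := by
  have hqr := nearest_mem_ball hp hρ hzp hd
  have hqr' := nearest_mem_ball hp hρ hwp hd'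
  have e1 := h.eq_sub_unitVec hD hz hqr hq hd
  have e2 := h.eq_sub_unitVec hD hw hqr' hq' hd'
  have hδ := bdist_lt hp hzp
  have hδ0 := bdist_pos hD hq hz
  have hlip : |bdist D w - bdist D z| ≤ ‖w - z‖ := by
    rw [← dist_eq_norm, abs_le]
    have a1 : bdist D w ≤ bdist D z + dist w z := Metric.infDist_le_infDist_add_dist
    have a2 : bdist D z ≤ bdist D w + dist z w := Metric.infDist_le_infDist_add_dist
    rw [dist_comm z w] at a2
    constructor <;> linarith
  have hid : q' - q = (w - z) + (bdist D w - bdist D z) • unitVec (g q') +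
      bdist D z • (unitVec (g q') - unitVec (g q)) := by
    generalize bdist D w = a at *
    generalize bdist D z = b at *
    rw [e1, e2, sub_smul, smul_sub]; abel
  have hu : ‖unitVec (g q')‖ = 1 := norm_unitVec (h.m_pos.trans_le (h.lower q' hqr'))
  have hν := h.norm_unitVec_sub_le hqr' hqr
  have hhalf : bdist D z * ‖unitVec (g q') - unitVec (g q)‖ ≤ 1 / 2 * ‖q' - q‖ := by
    have hm := h.m_pos
    have hL := h.L_pos
    have hc : bdist D z * (2 * L / m) ≤ 1 / 2 := by
      rw [← mul_div_assoc, div_le_iff₀ hm]; nlinarith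
    calc _ ≤ bdist D z * (2 * L / m * ‖q' - q‖) := by gcongr
      _ = bdist D z * (2 * L / m) * ‖q' - q‖ := by ring
      _ ≤ _ := by gcongr
  have : ‖q' - q‖ ≤ ‖w - z‖ + |bdist D w - bdist D z| * 1 +
      bdist D z * ‖unitVec (g q') - unitVec (g q)‖ := by
    conv_lhs => rw [hid]
    refine (norm_add₃_le).trans ?_
    rw [norm_smul, norm_smul, hu, Real.norm_eq_abs, Real.norm_eq_abs, abs_of_pos hδ0]
  linarith

/-- The distance from w to q' is at least its component along the normal at q. The difference q' - q
is tangential up to a quadratic error, because s vanishes at both points; 16 is the square of the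
constant in `norm_nearest_sub_le`. -/
theorem bdist_taylor_lower (h : LocalDefining D p s g r L m) (hD : IsOpen D)
    (hp : p ∈ frontier D) (hρ : 2 * ρ ≤ r) (hρm : 4 * L * ρ ≤ m) {z w q q' : Cn n}
    (hz : z ∈ D) (hzp : z ∈ Metric.ball p ρ) (hw : w ∈ D) (hwp : w ∈ Metric.ball p ρ)
    (hq : q ∈ frontier D) (hq' : q' ∈ frontier D) (hd : dist z q = bdist D z)
    (hd' : dist w q' = bdist D w) :
    -(16 * L / m * ‖w - z‖ ^ 2) ≤
      bdist D w - bdist D z + (herm (unitVec (g q)) (w - z)).re := by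
  have hqr := nearest_mem_ball hp hρ hzp hd
  have hqr' := nearest_mem_ball hp hρ hwp hd'
  have e1 := h.eq_sub_unitVec hD hz hqr hq hd
  have hu : ‖unitVec (g q)‖ = 1 := norm_unitVec (h.m_pos.trans_le (h.lower q hqr))
  have h1 : -(herm (unitVec (g q)) (w - q')).re ≤ bdist D w := by
    have := (abs_le.1 (abs_herm_re_le (unitVec (g q)) (w - q'))).1
    rw [hu, one_mul, ← dist_eq_norm, hd'] at this
    linarith
  have h2 : w - q' = (w - z) - bdist D z • unitVec (g q) - (q' - q) := by
    generalize bdist D z = b at *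
    rw [e1]; abel
  rw [h2, herm_sub, herm_sub, herm_real_smul, Complex.sub_re, Complex.sub_re,
    Complex.re_ofReal_mul, herm_self_re, hu] at h1
  have h3 := (abs_le.1 (h.abs_unitVec_herm_re_le hqr hqr' (h.eq_zero_of_mem_frontier hqr hq)
    (h.eq_zero_of_mem_frontier hqr' hq'))).1
  have h4 := h.norm_nearest_sub_le hD hp hρ hρm hz hzp hw hwp hq hq' hd hd'
  have hm := h.m_pos
  have hL := h.L_pos
  have h5 : L / m * ‖q' - q‖ ^ 2 ≤ L / m * (4 * ‖w - z‖) ^ 2 := by gcongr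
  have h6 : L / m * (4 * ‖w - z‖) ^ 2 = 16 * L / m * ‖w - z‖ ^ 2 := by ring
  linarith

/-- Near a `C²` boundary point the distance to the boundary is differentiable; its gradient is
the inner unit normal at the closest boundary point. -/
theorem hasGradientAt_bdist (h : LocalDefining D p s g r L m) (hD : IsOpen D)
    (hp : p ∈ frontier D) (hρ : 2 * ρ ≤ r) (hρm : 4 * L * ρ ≤ m) {z q : Cn n}
    (hz : z ∈ D) (hzp : z ∈ Metric.ball p ρ)
    (hq : q ∈ frontier D) (hd : dist z q = bdist D z) :
    HasGradientAt (bdist D) (-unitVec (g q)) z := by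
  rw [hasGradientAt_iff_isLittleO]
  have hm := h.m_pos
  have hL := h.L_pos
  have hO : (fun w => bdist D w - bdist D z - inner ℝ (-unitVec (g q)) (w - z)) =O[𝓝 z]
      fun w => ‖w - z‖ ^ 2 := by
    refine Asymptotics.IsBigO.of_bound (24 * L / m) ?_
    filter_upwards [hD.mem_nhds hz, Metric.isOpen_ball.mem_nhds hzp] with w hw hwp
    obtain ⟨q', hq', hd'⟩ := exists_nearest hp w
    have h1 := h.bdist_taylor_lower hD hp hρ hρm hz hzp hw hwp hq hq' hd hd'
    -- Exchanging z and w gives the upper estimate, with the normal at q' instead of q. Replacing it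
    -- costs a further 8L/m‖w-z‖², hence 24 = 16 + 8.
    have h2 := h.bdist_taylor_lower hD hp hρ hρm hw hwp hz hzp hq' hq hd' hd
    have hqr := nearest_mem_ball hp hρ hzp hd
    have hqr' := nearest_mem_ball hp hρ hwp hd'
    have h3 := h.norm_nearest_sub_le hD hp hρ hρm hz hzp hw hwp hq hq' hd hd'
    have h4 := h.norm_unitVec_sub_le hqr' hqr
    have h5 := (abs_le.1 (abs_herm_re_le (unitVec (g q') - unitVec (g q)) (w - z))).1
    have h6 : ‖unitVec (g q') - unitVec (g q)‖ * ‖w - z‖ ≤ 8 * L / m * ‖w - z‖ ^ 2 := by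
      calc _ ≤ 2 * L / m * (4 * ‖w - z‖) * ‖w - z‖ := by
            gcongr; exact h4.trans (by gcongr)
        _ = _ := by ring
    have h7 : z - w = -(w - z) := by abel
    rw [h7, norm_neg, herm_neg, Complex.neg_re] at h2
    rw [herm_sub_left, Complex.sub_re] at h5
    rw [inner_real_eq_herm_re, herm_neg_left, Complex.neg_re, Real.norm_eq_abs, norm_pow, norm_norm,
      abs_le]
    have h8 : 24 * L / m * ‖w - z‖ ^ 2 = 16 * L / m * ‖w - z‖ ^ 2 + 8 * L / m * ‖w - z‖ ^ 2 := by
      ring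
    have h9 : 0 ≤ 8 * L / m * ‖w - z‖ ^ 2 := by positivity
    constructor <;> linarith
  refine hO.trans_isLittleO ?_
  exact Asymptotics.isLittleO_pow_sub_sub z one_lt_two

theorem gradient_bdist (h : LocalDefining D p s g r L m) (hD : IsOpen D)
    (hp : p ∈ frontier D) (hρ : 2 * ρ ≤ r) (hρm : 4 * L * ρ ≤ m) {z q : Cn n}
    (hz : z ∈ D) (hzp : z ∈ Metric.ball p ρ)
    (hq : q ∈ frontier D) (hd : dist z q = bdist D z) :
    gradient (bdist D) z = -unitVec (g q) :=
  (h.hasGradientAt_bdist hD hp hρ hρm hz hzp hq hd).gradient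

theorem existsUnique_nearest (h : LocalDefining D p s g r L m) (hD : IsOpen D)
    (hp : p ∈ frontier D) (hρ : 2 * ρ ≤ r) (hρm : 4 * L * ρ ≤ m) {z : Cn n}
    (hz : z ∈ D) (hzp : z ∈ Metric.ball p ρ) :
    ∃! q, q ∈ frontier D ∧ dist z q = bdist D z := by
  obtain ⟨q, hq, hd⟩ := exists_nearest hp z
  refine ⟨q, ⟨hq, hd⟩, fun q' ⟨hq', hd'⟩ => ?_⟩
  have := h.norm_nearest_sub_le hD hp hρ hρm hz hzp hz hzp hq hq' hd hd'
  rw [sub_self, norm_zero, mul_zero] at this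
  exact sub_eq_zero.1 (norm_le_zero_iff.1 this)

/-- Taylor expansion at the closest point q, along the normal, gives s(z) ≤ -‖g q‖δ + Lδ², and Lδ ≤
m/4. -/
theorem le_neg_bdist (h : LocalDefining D p s g r L m) (hD : IsOpen D)
    (hp : p ∈ frontier D) (hρ : 2 * ρ ≤ r) (hρm : 4 * L * ρ ≤ m) {z : Cn n}
    (hz : z ∈ D) (hzp : z ∈ Metric.ball p ρ) : s z ≤ -(m / 2 * bdist D z) := by
  obtain ⟨q, hq, hd⟩ := exists_nearest hp z
  have hqr := nearest_mem_ball hp hρ hzp hd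
  have hδ := bdist_lt hp hzp
  have hδ0 := bdist_pos hD hq hz
  have e1 := h.eq_sub_unitVec hD hz hqr hq hd
  have hG := h.lower q hqr
  have hG0 := h.m_pos.trans_le hG
  have hzr : z ∈ Metric.ball p r := Metric.ball_subset_ball (by linarith) hzp
  have h1 := (abs_le.1 (h.taylor q hqr z hzr)).2
  have h2 : z - q = -(bdist D z • unitVec (g q)) := by
    generalize bdist D z = b at *
    rw [e1]; abel
  rw [← dist_eq_norm, hd, h2, herm_neg, herm_real_smul, h.eq_zero_of_mem_frontier hqr hq] at h1
  have h3 : (herm (g q) (unitVec (g q))).re = ‖g q‖ := by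
    rw [unitVec, herm_real_smul, Complex.re_ofReal_mul, herm_self_re]
    field_simp
  rw [Complex.neg_re, Complex.re_ofReal_mul, h3] at h1
  have hL := h.L_pos
  have h4 : L * bdist D z ^ 2 ≤ m / 4 * bdist D z := by
    rw [pow_two, ← mul_assoc]; gcongr; nlinarith
  nlinarith [mul_le_mul_of_nonneg_left hG hδ0.le, h.m_pos]

/-- The discs are governed by the gradient of s at z, but H_D by the normal at the closest point q.
The two gradients differ by at most Lδ since ‖z-q‖ = δ. -/
theorem norm_herm_le_normalComp (h : LocalDefining D p s g r L m) (hD : IsOpen D)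
    (hp : p ∈ frontier D) (hρ : 2 * ρ ≤ r) (hρm : 4 * L * ρ ≤ m) {z : Cn n}
    (hz : z ∈ D) (hzp : z ∈ Metric.ball p ρ) (v : Cn n) :
    ‖herm (g z) v‖ ≤ (‖g p‖ + L * r) * ‖normalComp D z v‖ + L * bdist D z * ‖v‖ := by
  obtain ⟨q, hq, hd⟩ := exists_nearest hp z
  have hqr := nearest_mem_ball hp hρ hzp hd
  have hG0 := h.m_pos.trans_le (h.lower q hqr)
  have hzr : z ∈ Metric.ball p r := Metric.ball_subset_ball (by linarith [dist_nonneg.trans_lt hzp]) hzp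
  have hL := h.L_pos
  rw [normalComp_eq_herm, h.gradient_bdist hD hp hρ hρm hz hzp hq hd, herm_neg_left, norm_neg]
  have h1 : herm (g z) v = ‖g q‖ * herm (unitVec (g q)) v + herm (g z - g q) v := by
    rw [← herm_real_smul_left, norm_smul_unitVec hG0, herm_sub_left]; ring
  have h2 : ‖g q‖ ≤ ‖g p‖ + L * r := by
    have := h.lip p (Metric.mem_ball_self h.r_pos) q hqr
    have h3 : ‖g q‖ ≤ ‖g p‖ + ‖g q - g p‖ := norm_le_norm_add_norm_sub' _ _
    have h4 : ‖q - p‖ ≤ r := by rw [← dist_eq_norm]; exact (Metric.mem_ball.1 hqr).le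
    nlinarith
  rw [h1]
  refine (norm_add_le _ _).trans (add_le_add ?_ ?_)
  · rw [norm_mul, Complex.norm_real, norm_norm]; gcongr
  · refine (norm_herm_le _ _).trans ?_
    gcongr
    rw [← hd, dist_eq_norm]
    exact h.lip q hqr z hzr

end LocalDefining

/-! ### Second order expansion and quadratic discs at a non-semipositive point. -/

section SecondOrder

variable {n : ℕ} {D : Set (Cn n)} {p : Cn n} {s : Cn n → ℝ}

theorem norm_gradient_sub (s : Cn n → ℝ) (x y : Cn n) :
    ‖gradient s x - gradient s y‖ = ‖fderiv ℝ s x - fderiv ℝ s y‖ := by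
  rw [gradient, gradient, ← map_sub, LinearIsometryEquiv.norm_map]

theorem norm_gradient (s : Cn n → ℝ) (x : Cn n) : ‖gradient s x‖ = ‖fderiv ℝ s x‖ := by
  rw [gradient, LinearIsometryEquiv.norm_map]

/-- The second order Taylor formula with expansion point and increment near `p`, and with the
second derivative frozen at `p`. -/
theorem eventually_taylor_two (hs : ContDiffAt ℝ 2 s p) {ε : ℝ} (hε : 0 < ε) :
    ∃ r > 0, ∀ z ∈ Metric.ball p r, ∀ x ∈ Metric.ball p r,
      ‖fderiv ℝ s x - fderiv ℝ s z - fderiv ℝ (fderiv ℝ s) p (x - z)‖ ≤ ε * ‖x - z‖ ∧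
      |s x - s z - (herm (gradient s z) (x - z)).re -
        fderiv ℝ (fderiv ℝ s) p (x - z) (x - z) / 2| ≤ ε * ‖x - z‖ ^ 2 := by
  set Q := fderiv ℝ (fderiv ℝ s) p with hQ
  have h1 : HasStrictFDerivAt (fderiv ℝ s) Q p :=
    (hs.fderiv_right (m := 1) (by norm_num)).hasStrictFDerivAt one_ne_zero
  have h2 := h1.isLittleO.def hε
  have h3 : ∀ᶠ x in 𝓝 p, DifferentiableAt ℝ s x := by
    filter_upwards [hs.eventually (by simp)] with x hx
    exact hx.differentiableAt two_ne_zero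
  obtain ⟨r₁, hr₁, H₁⟩ := Metric.eventually_nhds_iff_ball.1 h2
  obtain ⟨r₂, hr₂, H₂⟩ := Metric.eventually_nhds_iff_ball.1 h3
  refine ⟨min r₁ r₂, lt_min hr₁ hr₂, fun z hz x hx => ?_⟩
  have hstrict : ∀ x ∈ Metric.ball p (min r₁ r₂), ∀ z ∈ Metric.ball p (min r₁ r₂),
      ‖fderiv ℝ s x - fderiv ℝ s z - Q (x - z)‖ ≤ ε * ‖x - z‖ := fun x hx z hz =>
    H₁ (x, z) (by
      rw [← ball_prod_same]
      exact ⟨Metric.ball_subset_ball (min_le_left _ _) hx,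
        Metric.ball_subset_ball (min_le_left _ _) hz⟩)
  refine ⟨hstrict x hx z hz, ?_⟩
  set v := x - z with hv
  have hseg : ∀ t ∈ Set.Icc (0 : ℝ) 1, z + t • v ∈ Metric.ball p (min r₁ r₂) := by
    intro t ht
    have : z + t • v = (1 - t) • z + t • x := by rw [hv, smul_sub, sub_smul, one_smul]; abel
    rw [this]
    exact convex_ball p _ hz hx (by linarith [ht.2]) ht.1 (by ring)
  have hder : ∀ t ∈ Set.Icc (0 : ℝ) 1, HasDerivWithinAt
      (fun t : ℝ => s (z + t • v) - t * fderiv ℝ s z v - t ^ 2 / 2 * Q v v)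
      (fderiv ℝ s (z + t • v) v - fderiv ℝ s z v - t * Q v v) (Set.Icc 0 1) t := by
    intro t ht
    refine HasDerivAt.hasDerivWithinAt ?_
    have hd := (H₂ _ (Metric.ball_subset_ball (min_le_right _ _) (hseg t ht))).hasFDerivAt
    have hl : HasDerivAt (fun t : ℝ => z + t • v) v t := by
      simpa using ((hasDerivAt_id t).smul_const v).const_add z
    have h4 := hd.comp_hasDerivAt t hl
    have h5 : HasDerivAt (fun t : ℝ => t * fderiv ℝ s z v) (fderiv ℝ s z v) t := by
      simpa using (hasDerivAt_id t).mul_const (fderiv ℝ s z v)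
    have h6 : HasDerivAt (fun t : ℝ => t ^ 2 / 2 * Q v v) (t * Q v v) t := by
      refine (((hasDerivAt_pow 2 t).div_const 2).mul_const (Q v v)).congr_deriv ?_
      simp
    exact (h4.sub h5).sub h6
  have hbound : ∀ t ∈ Set.Ico (0 : ℝ) 1,
      ‖fderiv ℝ s (z + t • v) v - fderiv ℝ s z v - t * Q v v‖ ≤ ε * ‖v‖ ^ 2 := by
    intro t ht
    have h7 := hstrict _ (hseg t ⟨ht.1, ht.2.le⟩) z hz
    rw [add_sub_cancel_left] at h7
    have h8 := (fderiv ℝ s (z + t • v) - fderiv ℝ s z - Q (t • v)).le_of_opNorm_le h7 v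
    have h9 : (fderiv ℝ s (z + t • v) - fderiv ℝ s z - Q (t • v)) v =
      fderiv ℝ s (z + t • v) v - fderiv ℝ s z v - t * Q v v := by simp
    rw [h9, norm_smul, Real.norm_of_nonneg ht.1] at h8
    refine h8.trans ?_
    have : t * (ε * ‖v‖ ^ 2) ≤ 1 * (ε * ‖v‖ ^ 2) := by gcongr; exact ht.2.le
    nlinarith
  have := norm_image_sub_le_of_norm_deriv_le_segment_01' hder hbound
  rw [Real.norm_eq_abs] at this
  refine le_trans (le_of_eq ?_) this
  rw [← fderiv_eq_herm_re]
  congr 1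
  have hzx : z + v = x := by rw [hv]; abel
  simp [hzx]
  ring

/-- `eventually_taylor_two` with error 1 makes the gradient Lipschitz with constant L = ‖s''(p)‖ +
1. Within radius ‖∇s(p)‖/(2L) it keeps at least half of its norm. -/
theorem IsC2DefiningAt.exists_localDefining (h : IsC2DefiningAt D p s) :
    ∃ r L m, LocalDefining D p s (gradient s) r L m := by
  obtain ⟨r₁, hr₁, H⟩ := eventually_taylor_two h.contDiffAt one_pos
  obtain ⟨r₂, hr₂, H₂⟩ := Metric.eventually_nhds_iff_ball.1 h.mem_iff
  set Q := fderiv ℝ (fderiv ℝ s) p with hQ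
  have hm : 0 < ‖gradient s p‖ := by rw [norm_gradient]; exact norm_pos_iff.2 h.fderiv_ne
  set m := ‖gradient s p‖ with hmdef
  set L := ‖Q‖ + 1 with hL
  have hL0 : 0 < L := by positivity
  set r := min (min r₁ r₂) (m / (2 * L)) with hr
  have hr0 : 0 < r := by positivity
  have i1 : Metric.ball p r ⊆ Metric.ball p r₁ :=
    Metric.ball_subset_ball ((min_le_left _ _).trans (min_le_left _ _))
  have i2 : Metric.ball p r ⊆ Metric.ball p r₂ :=
    Metric.ball_subset_ball ((min_le_left _ _).trans (min_le_right _ _))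
  have lip : ∀ z ∈ Metric.ball p r, ∀ x ∈ Metric.ball p r,
      ‖gradient s x - gradient s z‖ ≤ L * ‖x - z‖ := by
    intro z hz x hx
    rw [norm_gradient_sub]
    have h1 := (H z (i1 hz) x (i1 hx)).1
    have h2 := Q.le_opNorm (x - z)
    have h3 := norm_le_norm_sub_add (fderiv ℝ s x - fderiv ℝ s z) (Q (x - z))
    rw [hL]; linarith
  refine ⟨r, L, m / 2, hr0, hL0, by positivity, fun z hz => H₂ z (i2 hz), ?_, lip, ?_⟩
  · intro z hz x hx
    have h1 := (H z (i1 hz) x (i1 hx)).2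
    have h2 : |Q (x - z) (x - z)| ≤ ‖Q‖ * ‖x - z‖ * ‖x - z‖ := Q.le_opNorm₂ _ _
    have h3 : 0 ≤ ‖Q‖ * ‖x - z‖ * ‖x - z‖ := by positivity
    rw [abs_le] at h1 h2 ⊢
    rw [hL]
    constructor <;> nlinarith
  · intro z hz
    have h1 := lip p (Metric.mem_ball_self hr0) z hz
    have h2 : ‖gradient s p‖ ≤ ‖gradient s z‖ + ‖gradient s z - gradient s p‖ := by
      rw [norm_sub_rev]; exact norm_le_norm_add_norm_sub' _ _
    have h3 : L * ‖z - p‖ ≤ m / 2 := by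
      have : ‖z - p‖ ≤ m / (2 * L) := by
        rw [← dist_eq_norm]; exact (Metric.mem_ball.1 hz).le.trans (min_le_right _ _)
      rw [le_div_iff₀ (by positivity)] at this
      linarith
    linarith

/-- The `ℂ`-quadratic part of the second derivative. -/
noncomputable def quadPart (s : Cn n → ℝ) (p u : Cn n) : ℂ :=
  ((fderiv ℝ (fderiv ℝ s) p u u -
    fderiv ℝ (fderiv ℝ s) p (Complex.I • u) (Complex.I • u)) / 4 : ℝ) -
  Complex.I * ((fderiv ℝ (fderiv ℝ s) p u (Complex.I • u) +
    fderiv ℝ (fderiv ℝ s) p (Complex.I • u) u) / 4 : ℝ)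

/-- The Levi term depends on |ζ| alone. The other term is the real part of a holomorphic monomial,
so a ζ² correction of the disc can cancel it. -/
theorem second_derivative_smul (s : Cn n → ℝ) (p u : Cn n) (ζ : ℂ) :
    fderiv ℝ (fderiv ℝ s) p (ζ • u) (ζ • u) / 2 =
      ‖ζ‖ ^ 2 * leviForm s p u + (ζ ^ 2 * quadPart s p u).re := by
  have hζ : ζ • u = ζ.re • u + ζ.im • (Complex.I • u) := by
    conv_lhs => rw [← Complex.re_add_im ζ]
    rw [add_smul, mul_smul, Complex.coe_smul, Complex.coe_smul]
  rw [hζ, Complex.sq_norm, Complex.normSq_apply, leviForm, quadPart]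
  simp [pow_two]
  ring

theorem continuous_leviForm (s : Cn n → ℝ) (p : Cn n) : Continuous (leviForm s p) := by
  unfold leviForm
  fun_prop

theorem continuous_quadPart (s : Cn n → ℝ) (p : Cn n) : Continuous (quadPart s p) := by
  unfold quadPart
  fun_prop

/-- A field of complex tangent directions, equal to `X` where `herm a X = 0`, `herm a N = 1`. -/
noncomputable def tangentField (X N a : Cn n) : Cn n := herm a N • X - herm a X • N

theorem herm_tangentField (X N a : Cn n) : herm a (tangentField X N a) = 0 := by
  rw [tangentField, herm_sub, herm_smul, herm_smul]; ring

theorem norm_tangentField_sub_le (X N a b : Cn n) :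
    ‖tangentField X N a - tangentField X N b‖ ≤ 2 * ‖X‖ * ‖N‖ * ‖a - b‖ := by
  have : tangentField X N a - tangentField X N b = herm (a - b) N • X - herm (a - b) X • N := by
    rw [tangentField, tangentField, herm_sub_left, herm_sub_left, sub_smul, sub_smul]; abel
  rw [this]
  refine (norm_sub_le _ _).trans ?_
  rw [norm_smul, norm_smul]
  have h1 := mul_le_mul_of_nonneg_right (norm_herm_le (a - b) N) (norm_nonneg X)
  have h2 := mul_le_mul_of_nonneg_right (norm_herm_le (a - b) X) (norm_nonneg N)
  nlinarith

theorem continuous_tangentField (X N : Cn n) : Continuous (tangentField X N) := by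
  unfold tangentField herm
  fun_prop

/-- Through every point near a non-semipositive boundary point pass quadratic discs of fixed size
along which the defining function decreases quadratically, up to the normal component of a small
perturbation `V` of the direction. -/
theorem exists_disc_estimate (h : IsC2DefiningAt D p s) {X : Cn n} (hX : fderiv ℝ s p X = 0)
    (hIX : fderiv ℝ s p (Complex.I • X) = 0) (hneg : leviForm s p X < 0) {R : ℝ} (hR : 0 < R) :
    ∃ (N Y : Cn n) (c ρ : ℝ), 0 < c ∧ 0 < ρ ∧ ∀ z ∈ Metric.ball p ρ, ∀ V : Cn n, ‖V‖ < ρ →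
      ∀ ζ : ℂ, ‖ζ‖ < ρ →
      z + ζ • (tangentField X N (gradient s z) + V + ζ • Y) ∈ Metric.ball p R ∧
      s (z + ζ • (tangentField X N (gradient s z) + V + ζ • Y)) ≤
        s z + ‖ζ‖ * ‖herm (gradient s z) V‖ - c * ‖ζ‖ ^ 2 := by
  set c₀ := -leviForm s p X with hc₀
  have hc0 : 0 < c₀ := by linarith
  set G := gradient s p with hG
  have hGpos : 0 < ‖G‖ := by rw [hG, norm_gradient]; exact norm_pos_iff.2 h.fderiv_ne
  have hXG : herm G X = 0 := by
    rw [fderiv_eq_herm_re] at hX hIX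
    rw [herm_smul] at hIX
    apply Complex.ext
    · simpa using hX
    · simpa using hIX
  -- The normalization ⟨G, N⟩ = 1 makes the tangent field equal to X at p.
  set N : Cn n := ((‖G‖ : ℂ) ^ 2)⁻¹ • G with hN
  have hNG : herm G N = 1 := by
    rw [hN, herm_smul, herm_self, inv_mul_cancel₀]
    exact pow_ne_zero _ (by exact_mod_cast hGpos.ne')
  -- The first order effect of ζ²Y cancels the ℂ-quadratic part of s'' on X.
  set Y : Cn n := -(quadPart s p X) • N with hY
  have hYG : herm G Y = -quadPart s p X := by rw [hY, herm_smul, hNG, mul_one]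
  set ε := c₀ / (4 * (‖X‖ ^ 2 + 1)) with hε
  have hε0 : 0 < ε := by positivity
  have hεX : ε * ‖X‖ ^ 2 < c₀ / 4 := by
    rw [hε, div_mul_eq_mul_div, div_lt_div_iff₀ (by positivity) (by norm_num)]
    nlinarith
  obtain ⟨r₁, hr₁, H⟩ := eventually_taylor_two h.contDiffAt hε0
  have hgc : ContinuousAt (gradient s) p := by
    have : ContinuousAt (fderiv ℝ s) p :=
      (h.contDiffAt.fderiv_right (m := 1) (by norm_num)).continuousAt
    exact (LinearIsometryEquiv.continuous _).continuousAt.comp this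
  set u : Cn n × Cn n × ℂ → Cn n := fun a =>
    tangentField X N (gradient s a.1) + a.2.1 + a.2.2 • Y with hu
  have hgc' : ContinuousAt (fun a : Cn n × Cn n × ℂ => gradient s a.1) (p, 0, 0) :=
    ContinuousAt.comp (f := fun a : Cn n × Cn n × ℂ => a.1) (g := gradient s) hgc
      continuousAt_fst
  have huc : ContinuousAt u (p, 0, 0) := by
    have h1 : ContinuousAt (fun a : Cn n × Cn n × ℂ => tangentField X N (gradient s a.1))
        (p, 0, 0) := (continuous_tangentField X N).continuousAt.comp hgc'
    have h2 : ContinuousAt (fun a : Cn n × Cn n × ℂ => a.2.1) (p, 0, 0) := by fun_prop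
    have h3 : ContinuousAt (fun a : Cn n × Cn n × ℂ => a.2.2 • Y) (p, 0, 0) := by fun_prop
    exact (h1.add h2).add h3
  have hup : u (p, 0, 0) = X := by
    simp only [hu, tangentField]
    rw [← hG, hNG, hXG]; simp
  -- F bounds the coefficient of |ζ|² in s along the disc. At (p,0,0) it equals -c₀ + ε‖X‖² < -c₀/2,
  -- which persists nearby by continuity.
  set F : Cn n × Cn n × ℂ → ℝ := fun a => leviForm s p (u a) +
    ‖quadPart s p (u a) + herm (gradient s a.1) Y‖ + ε * ‖u a‖ ^ 2 with hF
  have hFc : ContinuousAt F (p, 0, 0) := by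
    have h1 := (continuous_leviForm s p).continuousAt.comp huc
    have h2 := (continuous_quadPart s p).continuousAt.comp huc
    have h3 : ContinuousAt (fun a : Cn n × Cn n × ℂ => herm (gradient s a.1) Y) (p, 0, 0) :=
      (continuous_herm.comp (Continuous.prodMk_left Y)).continuousAt.comp hgc'
    exact (h1.add (h2.add h3).norm).add (continuousAt_const.mul (huc.norm.pow 2))
  have hFp : F (p, 0, 0) < -(c₀ / 2) := by
    simp only [hF]
    rw [hup, ← hG, hYG, add_neg_cancel, norm_zero]
    linarith
  have hpt : ContinuousAt (fun a : Cn n × Cn n × ℂ => a.1 + a.2.2 • u a) (p, 0, 0) := by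
    have h2 : ContinuousAt (fun a : Cn n × Cn n × ℂ => a.1) (p, 0, 0) := by fun_prop
    have h3 : ContinuousAt (fun a : Cn n × Cn n × ℂ => a.2.2) (p, 0, 0) := by fun_prop
    exact h2.add (h3.smul huc)
  have hpt' : ∀ᶠ a in 𝓝 ((p, 0, 0) : Cn n × Cn n × ℂ),
      a.1 + a.2.2 • u a ∈ Metric.ball p (min R r₁) :=
    hpt.eventually_mem (Metric.isOpen_ball.mem_nhds (by simp [hR, hr₁]))
  obtain ⟨ρ, hρ, Hρ⟩ := Metric.eventually_nhds_iff_ball.1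
    ((hFc.eventually_lt_const hFp).and hpt')
  refine ⟨N, Y, c₀ / 2, min ρ r₁, by positivity, by positivity, fun z hz V hV ζ hζ => ?_⟩
  have hmem : (z, V, ζ) ∈ Metric.ball ((p, 0, 0) : Cn n × Cn n × ℂ) ρ := by
    rw [← ball_prod_same, ← ball_prod_same]
    refine ⟨Metric.ball_subset_ball (min_le_left _ _) hz, ?_, ?_⟩
    · rw [mem_ball_zero_iff]; exact hV.trans_le (min_le_left _ _)
    · rw [mem_ball_zero_iff]; exact hζ.trans_le (min_le_left _ _)
  obtain ⟨h1, h2⟩ := Hρ _ hmem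
  have hub : u (z, V, ζ) = tangentField X N (gradient s z) + V + ζ • Y := rfl
  simp only [hF] at h1
  simp only at h2
  rw [← hub]
  set v := u (z, V, ζ)
  refine ⟨Metric.ball_subset_ball (min_le_left _ _) h2, ?_⟩
  have h3 := (abs_le.1 (H z (Metric.ball_subset_ball (min_le_right _ _) hz) _
    (Metric.ball_subset_ball (min_le_right _ _) h2)).2).2
  rw [add_sub_cancel_left, second_derivative_smul] at h3
  have h4 : herm (gradient s z) (ζ • v) =
      ζ * herm (gradient s z) V + ζ ^ 2 * herm (gradient s z) Y := by
    rw [herm_smul, hub, herm_add, herm_add, herm_tangentField, herm_smul]; ring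
  have h5 : (ζ * herm (gradient s z) V).re ≤ ‖ζ‖ * ‖herm (gradient s z) V‖ := by
    rw [← norm_mul]; exact Complex.re_le_norm _
  have h6 : (ζ ^ 2 * quadPart s p v).re + (ζ ^ 2 * herm (gradient s z) Y).re ≤
      ‖ζ‖ ^ 2 * ‖quadPart s p v + herm (gradient s z) Y‖ := by
    rw [← norm_pow, ← norm_mul, ← Complex.add_re, ← mul_add]; exact Complex.re_le_norm _
  rw [h4, Complex.add_re, norm_smul] at h3
  have h7 : ‖ζ‖ ^ 2 * (leviForm s p v + ‖quadPart s p v + herm (gradient s z) Y‖ +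
      ε * ‖v‖ ^ 2) ≤ ‖ζ‖ ^ 2 * (-(c₀ / 2)) := by gcongr
  nlinarith

end SecondOrder

/-! ### Lower bound. -/

section LowerBound

/-- Pass through v²/(v+a). With a fixed, the difference factors through v - u; with v fixed, the
quotient is 1-Lipschitz in a. Here u and v stand for the square roots of normal components. -/
theorem abs_sq_div_sub_le {u v a b : ℝ} (hu : 0 ≤ u) (hv : 0 ≤ v) (ha : 0 < a) (hb : 0 < b) :
    |v ^ 2 / (v + b) - u ^ 2 / (u + a)| ≤ |v ^ 2 - u ^ 2| / (u + a) + |b - a| := by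
  have h1 : |v ^ 2 / (v + a) - u ^ 2 / (u + a)| ≤ |v ^ 2 - u ^ 2| / (u + a) := by
    have e1 : v ^ 2 / (v + a) - u ^ 2 / (u + a) =
        (v - u) * (u * v + a * (u + v)) / ((v + a) * (u + a)) := by
      field_simp; ring
    have e2 : v ^ 2 - u ^ 2 = (v - u) * (u + v) := by ring
    rw [e1, e2, abs_div, abs_mul (v - u), abs_mul (v - u), abs_of_nonneg (show 0 ≤ u * v + a * (u + v) by positivity),
      abs_of_nonneg (show 0 ≤ u + v by positivity),
      abs_of_pos (show 0 < (v + a) * (u + a) by positivity),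
      div_le_div_iff₀ (by positivity) (by positivity)]
    have h3 : u * v + a * (u + v) ≤ (u + v) * (v + a) := by nlinarith
    calc |v - u| * (u * v + a * (u + v)) * (u + a)
        ≤ |v - u| * ((u + v) * (v + a)) * (u + a) := by gcongr
      _ = _ := by ring
  have h2 : |v ^ 2 / (v + b) - v ^ 2 / (v + a)| ≤ |b - a| := by
    have e1 : v ^ 2 / (v + b) - v ^ 2 / (v + a) = (a - b) * (v ^ 2 / ((v + b) * (v + a))) := by
      field_simp; ring
    have e2 : v ^ 2 / ((v + b) * (v + a)) ≤ 1 := by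
      rw [div_le_one (by positivity)]
      nlinarith [mul_nonneg hv ha.le, mul_nonneg hv hb.le, mul_pos ha hb]
    rw [e1, abs_mul, abs_of_nonneg (show 0 ≤ v ^ 2 / ((v + b) * (v + a)) by positivity),
      abs_sub_comm a b]
    exact mul_le_of_le_one_right (abs_nonneg _) e2
  have := abs_sub_le (v ^ 2 / (v + b)) (v ^ 2 / (v + a)) (u ^ 2 / (u + a))
  linarith

/-- The change of A is divided by √A + t + σ. So a normal component moving at speed O(√A + t + σ)
changes H_D at bounded speed. -/
theorem abs_gauge_sub_le {A A' t t' σ : ℝ} (hA : 0 ≤ A) (hA' : 0 ≤ A') (ht : 0 ≤ t) (ht' : 0 ≤ t')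
    (hσ : 0 < σ) :
    |(A' / (√A' + t' + σ) + t') - (A / (√A + t + σ) + t)| ≤
      |A' - A| / (√A + t + σ) + 2 * |t' - t| := by
  have h := abs_sq_div_sub_le (Real.sqrt_nonneg A) (Real.sqrt_nonneg A')
    (show 0 < t + σ by linarith) (show 0 < t' + σ by linarith)
  rw [Real.sq_sqrt hA, Real.sq_sqrt hA', ← add_assoc, ← add_assoc, add_sub_add_right_eq_sub] at h
  have e : (A' / (√A' + t' + σ) + t') - (A / (√A + t + σ) + t) =
    (A' / (√A' + t' + σ) - A / (√A + t + σ)) + (t' - t) := by ring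
  rw [e]
  refine (abs_add_le _ _).trans ?_
  linarith

/-- A Schwarz type estimate near the centre for a function with real part bounded below. -/
theorem norm_sub_le_of_re_ge {G : ℂ → ℂ} {σ κ B : ℝ} (hσ : 0 < σ) (hκ : 0 < κ) (hB : 0 ≤ B)
    (hG : DifferentiableOn ℂ G (Metric.ball 0 (κ * σ)))
    (hre : ∀ ζ ∈ Metric.ball (0 : ℂ) (κ * σ), -(B * σ ^ 2) ≤ (G ζ).re)
    (h0 : ‖G 0‖ ≤ σ ^ 2) {ζ : ℂ} (hζ : ‖ζ‖ ≤ κ * σ / 2) :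
    ‖G ζ - G 0‖ ≤ 4 * (1 + B) / κ * ‖ζ‖ * σ := by
  have hR : 0 < κ * σ := by positivity
  have key := Complex.borelCaratheodory_zero (f := fun ζ => G 0 - G ζ) (M := (1 + B) * σ ^ 2)
    (R := κ * σ) (z := ζ) (by positivity) (hG.const_sub _) (by
      intro x hx
      have h1 := hre x hx
      have h2 := Complex.re_le_norm (G 0)
      show (G 0 - G x).re ≤ _
      rw [Complex.sub_re]
      linarith) hR (by rw [mem_ball_zero_iff]; linarith) (sub_self _)
  rw [norm_sub_rev]
  refine key.trans ?_
  calc 2 * ((1 + B) * σ ^ 2) * ‖ζ‖ / (κ * σ - ‖ζ‖)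
      ≤ 2 * ((1 + B) * σ ^ 2) * ‖ζ‖ / (κ * σ / 2) := by
        gcongr; linarith
    _ = _ := by field_simp; ring

variable {n : ℕ} {D : Set (Cn n)} {p : Cn n} {s : Cn n → ℝ} {g : Cn n → Cn n} {r L m ρ : ℝ}

namespace LocalDefining

/-- Near a `C²` boundary point the domain lies outside a paraboloid touching the boundary. -/
theorem herm_inner_normal_ge (h : LocalDefining D p s g r L m) {q x : Cn n}
    (hq : q ∈ Metric.ball p r) (hs : s q = 0) (hx : x ∈ Metric.ball p r) (hxD : x ∈ D) :
    -(L / m * ‖x - q‖ ^ 2) ≤ (herm (-unitVec (g q)) (x - q)).re := by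
  have h1 := (abs_le.1 (h.taylor q hq x hx)).1
  have h2 := (h.mem_iff x hx).1 hxD
  have hm := h.m_pos
  have hL := h.L_pos
  have hG := h.lower q hq
  have hG0 := hm.trans_le hG
  rw [herm_neg_left, Complex.neg_re, neg_le_neg_iff, unitVec, herm_real_smul_left,
    Complex.re_ofReal_mul, inv_mul_le_iff₀ hG0]
  have h3 : m * (L / m * ‖x - q‖ ^ 2) ≤ ‖g q‖ * (L / m * ‖x - q‖ ^ 2) := by gcongr
  have h4 : m * (L / m * ‖x - q‖ ^ 2) = L * ‖x - q‖ ^ 2 := by field_simp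
  linarith

/-- The normal component of an analytic disc in `D` starting near the closest boundary point `q`
of `z` varies slowly. -/
theorem norm_herm_disc_sub_le (h : LocalDefining D p s g r L m) {z q : Cn n} {δ M κ σ : ℝ}
    (hqr : q ∈ Metric.ball p r) (hsq : s q = 0) (hzq : ‖z - q‖ = δ) (hδ0 : 0 ≤ δ) (hδ1 : δ ≤ 1)
    (hzp : z ∈ Metric.ball p (r / 4)) {φ : ℂ → Cn n}
    (hφ : DifferentiableOn ℂ φ (Metric.ball 0 1)) (hφD : Set.MapsTo φ (Metric.ball 0 1) D)
    (hφM : ∀ ζ : ℂ, ‖ζ‖ < 1 → ‖φ ζ - φ 0‖ ≤ M * ‖ζ‖) (hM0 : 0 < M) (hnear : ‖z - φ 0‖ ≤ r / 4)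
    (hκ0 : 0 < κ) (hMκ1 : M * κ ≤ 1) (hMκ : M * (κ * σ) ≤ min 1 (r / 4)) (hσ0 : 0 < σ)
    (hσ : √‖herm (-unitVec (g q)) (z - φ 0)‖ + ‖z - φ 0‖ + √δ = σ) (hκσ1 : κ * σ ≤ 1)
    {ζ : ℂ} (hζ : ‖ζ‖ ≤ κ * σ / 2) :
    ‖herm (-unitVec (g q)) (φ ζ - q) - herm (-unitVec (g q)) (φ 0 - q)‖ ≤
      4 * (1 + 9 * (L / m)) / κ * ‖ζ‖ * σ := by
  have hm := h.m_pos
  have hL := h.L_pos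
  set ν := -unitVec (g q) with hν
  have hν1 : ‖ν‖ = 1 := by rw [hν, norm_neg, norm_unitVec (hm.trans_le (h.lower q hqr))]
  set x := φ 0 with hx
  have hA0 : 0 ≤ √‖herm ν (z - x)‖ := Real.sqrt_nonneg _
  have ht0 := norm_nonneg (z - x)
  have hs0 := Real.sqrt_nonneg δ
  have hδσ : δ ≤ σ := by
    have : δ ≤ √δ := Real.le_sqrt_of_sq_le (by nlinarith)
    linarith
  have htσ : ‖z - x‖ ≤ σ := by linarith
  have hsub : Metric.ball (0 : ℂ) (κ * σ) ⊆ Metric.ball 0 1 := Metric.ball_subset_ball hκσ1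
  have hdiff : ∀ ζ ∈ Metric.ball (0 : ℂ) (κ * σ), ‖φ ζ - x‖ ≤ M * (κ * σ) := by
    intro ζ hζ
    refine (hφM ζ (mem_ball_zero_iff.1 (hsub hζ))).trans ?_
    gcongr
    exact (mem_ball_zero_iff.1 hζ).le
  have hMσ : M * (κ * σ) ≤ σ := by
    rw [← mul_assoc]; exact mul_le_of_le_one_left hσ0.le hMκ1
  refine norm_sub_le_of_re_ge (G := fun ζ => herm ν (φ ζ - q)) hσ0 hκ0 (by positivity) ?_ ?_ ?_ hζ
  · exact (innerSL ℂ ν).differentiable.comp_differentiableOn ((hφ.mono hsub).sub_const q)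
  · intro ζ hζ
    have h1 := hdiff ζ hζ
    have h2 := h1.trans (hMκ.trans (min_le_right _ _))
    have h4 := norm_sub_le (φ ζ - x) (z - x)
    have hmem : φ ζ ∈ Metric.ball p r := by
      rw [Metric.mem_ball, dist_eq_norm]
      have e : φ ζ - p = (φ ζ - x) - (z - x) + (z - p) := by abel
      have hzp' : ‖z - p‖ < r / 4 := by rw [← dist_eq_norm]; exact hzp
      rw [e]
      refine (norm_add_le _ _).trans_lt ?_
      linarith
    refine le_trans ?_ (h.herm_inner_normal_ge hqr hsq hmem (hφD (hsub hζ)))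
    -- Each of ‖φ ζ - x‖, ‖z - x‖ and ‖z - q‖ = δ ≤ √δ is at most σ; this is the source of the 9 in
    -- the bound.
    have h3 : ‖φ ζ - q‖ ≤ 3 * σ := by
      have e : φ ζ - q = (φ ζ - x) - (z - x) + (z - q) := by abel
      rw [e]
      refine (norm_add_le _ _).trans ?_
      linarith
    rw [neg_le_neg_iff]
    calc L / m * ‖φ ζ - q‖ ^ 2 ≤ L / m * (3 * σ) ^ 2 := by gcongr
      _ = _ := by ring
  · have e : φ 0 - q = -(z - x) + (z - q) := by rw [← hx]; abel
    simp only [e]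
    rw [herm_add, herm_neg]
    refine (norm_add_le _ _).trans ?_
    rw [norm_neg]
    have h1 : ‖herm ν (z - q)‖ ≤ δ := by
      refine (norm_herm_le _ _).trans ?_
      rw [hν1, one_mul, hzq]
    have h2 := Real.sq_sqrt (norm_nonneg (herm ν (z - x)))
    have h3 := Real.sq_sqrt hδ0
    rw [← hσ]
    generalize √‖herm ν (z - x)‖ = a at *
    generalize √δ = b at *
    nlinarith [mul_nonneg hA0 ht0, mul_nonneg hA0 hs0, mul_nonneg ht0 hs0]

theorem HD_le (D : Set (Cn n)) (z w : Cn n) :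
    HD D z w ≤ √‖normalComp D z (z - w)‖ + ‖z - w‖ := by
  rw [HD]
  gcongr
  rcases (Real.sqrt_nonneg ‖normalComp D z (z - w)‖).eq_or_lt with h | h
  · rw [← h, Real.sqrt_eq_zero (norm_nonneg _) |>.1 h.symm, zero_div]
  · rw [div_le_iff₀ (by positivity)]
    nlinarith [Real.mul_self_sqrt (norm_nonneg (normalComp D z (z - w))), norm_nonneg (z - w),
      Real.sqrt_nonneg (bdist D z), mul_nonneg h.le (norm_nonneg (z - w)),
      mul_nonneg h.le (Real.sqrt_nonneg (bdist D z))]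

set_option maxHeartbeats 800000 in
/-- The lower estimate of the Kobayashi pseudodistance of a bounded domain near a `C²` boundary
point. -/
theorem exists_le_kobayashi (h : LocalDefining D p s g r L m) (hD : IsOpen D)
    (hp : p ∈ frontier D) (hρr : 4 * ρ ≤ r) (hρm : 4 * L * ρ ≤ m) (hρ1 : ρ ≤ 1)
    (hb : Bornology.IsBounded D) :
    ∃ c : ℝ, 0 < c ∧ ∀ z ∈ D ∩ Metric.ball p ρ, ∀ w ∈ D ∩ Metric.ball p ρ,
      ENNReal.ofReal (c * HD D z w) ≤ kobayashi D z w := by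
  rcases le_or_gt ρ 0 with hρ | hρ0
  · exact ⟨1, one_pos, fun z hz => by simp [Metric.ball_eq_empty.2 hρ] at hz⟩
  have hm := h.m_pos
  have hL := h.L_pos
  have hr := h.r_pos
  have hρ2 : 2 * ρ ≤ r := by linarith
  obtain ⟨M₀, hM₀⟩ := Metric.isBounded_iff.1 hb
  set M := max M₀ 1 with hM
  have hM1 : 1 ≤ M := le_max_right _ _
  have hMD : ∀ x ∈ D, ∀ y ∈ D, dist x y ≤ M := fun x hx y hy =>
    (hM₀ hx hy).trans (le_max_left _ _)
  -- Truncation level: if ‖z-x‖ > r/4 then H_D(z,x) exceeds c₀, and the truncated function is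
  -- constant near x. The local geometry is needed only for nearer points.
  set c₀ := r / 4 with hc₀
  have hc0 : 0 < c₀ := by positivity
  set S := √c₀ + c₀ + 1 with hS
  have hS1 : 1 ≤ S := by have := Real.sqrt_nonneg c₀; linarith
  set κ := min 1 (r / 4) / (M * S) with hκ
  have hMS : 0 < M * S := by positivity
  have hκ0 : 0 < κ := by positivity
  have hκS : M * κ * S ≤ min 1 (r / 4) := by
    refine le_of_eq ?_
    rw [hκ]; field_simp
  set B := 9 * (L / m) with hB
  have hB0 : 0 ≤ B := by positivity
  set K := 4 * (1 + B) / κ + 2 * M with hK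
  have hK0 : 0 < K := by positivity
  -- T bounds H_D on the small ball, so truncation loses at most the factor c₀/(c₀+T).
  set T := √(2 * ρ) + 2 * ρ with hT
  have hT0 : 0 ≤ T := by positivity
  refine ⟨c₀ / (c₀ + T) / (2 * K), by positivity, fun z hz w hw => ?_⟩
  obtain ⟨hzD, hzp⟩ := hz
  obtain ⟨hwD, hwp⟩ := hw
  obtain ⟨q, hq, hd⟩ := exists_nearest hp z
  have hqr := nearest_mem_ball hp hρ2 hzp hd
  have hδ := bdist_lt hp hzp
  have hδ0 := bdist_pos hD hq hzD
  have hgrad := h.gradient_bdist hD hp hρ2 hρm hzD hzp hq hd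
  have hsq := h.eq_zero_of_mem_frontier hqr hq
  set ν := -unitVec (g q) with hν
  have hν1 : ‖ν‖ = 1 := by rw [hν, norm_neg, norm_unitVec (hm.trans_le (h.lower q hqr))]
  set δ := bdist D z with hδdef
  have hσδ : 0 < √δ := Real.sqrt_pos.2 hδ0
  have hHD : ∀ x, HD D z x = ‖herm ν (z - x)‖ / (√‖herm ν (z - x)‖ + ‖z - x‖ + √δ) + ‖z - x‖ :=
    fun x => by rw [HD, normalComp_eq_herm, hgrad]
  have hAle : ∀ x, ‖herm ν (z - x)‖ ≤ ‖z - x‖ := fun x =>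
    (norm_herm_le _ _).trans_eq (by rw [hν1, one_mul])
  have hHge : ∀ x, ‖z - x‖ ≤ HD D z x := fun x => by
    rw [hHD]; exact le_add_of_nonneg_left (by positivity)
  have hlip := abs_sub_le_kobayashi (D := D) (f := fun x => min c₀ (HD D z x)) hK0 (by
    intro φ hφ hφD
    have hφ0 : φ 0 ∈ D := hφD (Metric.mem_ball_self one_pos)
    have hφM : ∀ ζ : ℂ, ‖ζ‖ < 1 → ‖φ ζ - φ 0‖ ≤ M * ‖ζ‖ := by
      intro ζ hζ
      have := Complex.dist_le_div_mul_dist_of_mapsTo_ball (R₂ := M) hφ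
        (fun x hx => hMD _ (hφD hx) _ hφ0) (mem_ball_zero_iff.2 hζ)
      rwa [div_one, dist_zero_right, dist_eq_norm] at this
    rcases lt_or_ge c₀ ‖z - φ 0‖ with hfar | hnear
    · have hcont : ContinuousAt (fun ζ => ‖z - φ ζ‖) 0 :=
        (continuousAt_const.sub (hφ.continuousOn.continuousAt
          (Metric.ball_mem_nhds _ one_pos))).norm
      filter_upwards [hcont.eventually_const_lt hfar] with ζ hζ
      rw [min_eq_left (hζ.le.trans (hHge _)), min_eq_left (hfar.le.trans (hHge _)), sub_self,
        abs_zero]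
      positivity
    set x := φ 0 with hx
    set σ := √‖herm ν (z - x)‖ + ‖z - x‖ + √δ with hσ
    have hσ0 : 0 < σ := by positivity
    have hσS : σ ≤ S := by
      have h1 : √‖herm ν (z - x)‖ ≤ √c₀ := Real.sqrt_le_sqrt ((hAle x).trans hnear)
      have h2 : √δ ≤ 1 := Real.sqrt_le_one.2 (by linarith)
      linarith
    have hzq : ‖z - q‖ = δ := by rw [← dist_eq_norm, hd]
    have hMκ : M * (κ * σ) ≤ min 1 (r / 4) := by
      refine le_trans ?_ hκS
      rw [mul_assoc]; gcongr
    have hκσ1 : κ * σ ≤ 1 :=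
      (le_mul_of_one_le_left (by positivity) hM1).trans (hMκ.trans (min_le_left _ _))
    have hMκ1 : M * κ ≤ 1 :=
      (le_mul_of_one_le_right (by positivity) hS1).trans (hκS.trans (min_le_left _ _))
    have hball : Metric.ball (0 : ℂ) (κ * σ / 2) ∈ 𝓝 (0 : ℂ) :=
      Metric.ball_mem_nhds _ (by positivity)
    filter_upwards [hball] with ζ hζ
    rw [mem_ball_zero_iff] at hζ
    have hA := h.norm_herm_disc_sub_le hqr hsq hzq hδ0.le (by linarith)
      (Metric.ball_subset_ball (by linarith) hzp) hφ hφD hφM (by linarith) hnear hκ0 hMκ1 hMκ hσ0 rfl hκσ1 hζ.le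
    have hζ1 : ‖ζ‖ < 1 := by linarith
    have ht : |‖z - φ ζ‖ - ‖z - x‖| ≤ M * ‖ζ‖ := by
      refine (abs_norm_sub_norm_le _ _).trans ?_
      rw [sub_sub_sub_cancel_left, norm_sub_rev]
      exact hφM ζ hζ1
    have hA' : |‖herm ν (z - φ ζ)‖ - ‖herm ν (z - x)‖| ≤ 4 * (1 + B) / κ * ‖ζ‖ * σ := by
      refine (abs_norm_sub_norm_le _ _).trans ?_
      rw [← herm_sub, sub_sub_sub_cancel_left, ← sub_sub_sub_cancel_right x (φ ζ) q, herm_sub,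
        norm_sub_rev]
      exact hA
    have hfin := abs_gauge_sub_le (norm_nonneg (herm ν (z - x))) (norm_nonneg (herm ν (z - φ ζ)))
      (norm_nonneg (z - x)) (norm_nonneg (z - φ ζ)) hσδ
    rw [← hHD, ← hHD] at hfin
    have h1 : |‖herm ν (z - φ ζ)‖ - ‖herm ν (z - x)‖| / σ ≤ 4 * (1 + B) / κ * ‖ζ‖ := by
      rwa [div_le_iff₀ hσ0]
    have h2 : |min c₀ (HD D z (φ ζ)) - min c₀ (HD D z x)| ≤ |HD D z (φ ζ) - HD D z x| := by
      have := abs_min_sub_min_le_max c₀ (HD D z (φ ζ)) c₀ (HD D z x)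
      rwa [sub_self, abs_zero, max_eq_right (abs_nonneg _)] at this
    refine h2.trans (hfin.trans ?_)
    rw [hK, add_mul]
    linarith) z w
  refine le_trans (ENNReal.ofReal_le_ofReal ?_) hlip
  have hz0 : HD D z z = 0 := by rw [hHD]; simp [herm]
  have hw0 : 0 ≤ HD D z w := (norm_nonneg _).trans (hHge w)
  have hwT : HD D z w ≤ T := by
    refine (HD_le D z w).trans ?_
    have h1 : ‖z - w‖ ≤ 2 * ρ := by
      rw [← dist_eq_norm]
      have := dist_triangle_right z w p
      have a1 := Metric.mem_ball.1 hzp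
      have a2 := Metric.mem_ball.1 hwp
      linarith
    have h2 : ‖normalComp D z (z - w)‖ ≤ 2 * ρ := by
      rw [normalComp_eq_herm, hgrad]; exact (hAle w).trans h1
    have := Real.sqrt_le_sqrt h2
    linarith
  simp only [hz0]
  rw [min_eq_right hc0.le, zero_sub, abs_neg, abs_of_nonneg (le_min hc0.le hw0), div_mul_eq_mul_div]
  gcongr
  refine le_min ?_ ?_
  · rw [div_mul_eq_mul_div, div_le_iff₀ (by positivity)]
    gcongr; linarith
  · exact mul_le_of_le_one_left hw0 (by rw [div_le_one (by positivity)]; linarith)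

end LocalDefining

end LowerBound

/-! ### Chaining two quadratic discs. -/

/-- `T` is a Lipschitz field of directions near `p` such that the quadratic discs
`ζ ↦ z + ζ (T z + V + ζ Y)` stay near `p`, with `s` decreasing quadratically along them. -/
structure DiscField {n : ℕ} (p : Cn n) (s : Cn n → ℝ) (g T : Cn n → Cn n) (Y : Cn n)
    (r c ρ Λ : ℝ) : Prop where
  c_pos : 0 < c
  ρ_pos : 0 < ρ
  ρ_le : ρ ≤ r
  Λ_nonneg : 0 ≤ Λ
  lip : ∀ z ∈ Metric.ball p ρ, ∀ w ∈ Metric.ball p ρ, ‖T z - T w‖ ≤ Λ * ‖z - w‖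
  disc : ∀ z ∈ Metric.ball p ρ, ∀ V : Cn n, ‖V‖ < ρ → ∀ ζ : ℂ, ‖ζ‖ < ρ →
    z + ζ • (T z + V + ζ • Y) ∈ Metric.ball p r ∧
    s (z + ζ • (T z + V + ζ • Y)) ≤ s z + ‖ζ‖ * ‖herm (g z) V‖ - c * ‖ζ‖ ^ 2

namespace DiscField

variable {n : ℕ} {D : Set (Cn n)} {p : Cn n} {s : Cn n → ℝ} {g T : Cn n → Cn n} {Y : Cn n}
  {r L m c ρ Λ G : ℝ}

/-- The end point of a quadratic disc is close to its centre for the Kobayashi pseudodistance. -/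
theorem kobayashi_le (H : DiscField p s g T Y r c ρ Λ) (h : LocalDefining D p s g r L m)
    {z V : Cn n} (hz : z ∈ D) (hzp : z ∈ Metric.ball p ρ) (hV : ‖V‖ < ρ)
    (ha : ‖herm (g z) V‖ ^ 2 ≤ c * -s z) {τ : ℝ} (hτ : 0 ≤ τ) (hτρ : τ ≤ ρ / 2) :
    z + (τ : ℂ) • (T z + V + (τ : ℂ) • Y) ∈ D ∧
    kobayashi D z (z + (τ : ℂ) • (T z + V + (τ : ℂ) • Y)) ≤ ENNReal.ofReal (2 * τ / ρ) := by
  have hs : s z < 0 := (h.mem_iff z (Metric.ball_subset_ball H.ρ_le hzp)).1 hz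
  have hmaps : Set.MapsTo (fun ζ : ℂ => z + ζ • (T z + V + ζ • Y)) (Metric.ball 0 ρ) D := by
    intro ζ hζ
    obtain ⟨h1, h2⟩ := H.disc z hzp V hV ζ (mem_ball_zero_iff.1 hζ)
    refine (h.mem_iff _ h1).2 (h2.trans_lt ?_)
    have hc := H.c_pos
    -- With `ha` this square gives 2|ζ||⟨g,V⟩| - c|ζ|² ≤ -s(z), so s stays below s(z)/2 on the disc.
    have h3 : 0 ≤ (c * ‖ζ‖ - ‖herm (g z) V‖) ^ 2 := sq_nonneg _
    have h4 : c * (2 * (‖ζ‖ * ‖herm (g z) V‖) - c * ‖ζ‖ ^ 2) ≤ c * -s z := by nlinarith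
    have h5 := le_of_mul_le_mul_left h4 hc
    have h6 : 0 ≤ c * ‖ζ‖ ^ 2 := by positivity
    linarith
  refine ⟨hmaps (mem_ball_zero_iff.2 ?_), ?_⟩
  · rw [Complex.norm_real, Real.norm_of_nonneg hτ]
    linarith [H.ρ_pos]
  · have := kobayashi_le_of_disc (ψ := fun ζ : ℂ => z + ζ • (T z + V + ζ • Y)) H.ρ_pos
      (by fun_prop) hmaps hτ hτρ
    simpa using this

/-- Two discs with a common end point, centred at `z` and `w`. -/
theorem kobayashi_le_of_two_discs (H : DiscField p s g T Y r c ρ Λ)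
    (h : LocalDefining D p s g r L m) (hG : ∀ z ∈ Metric.ball p ρ, ‖g z‖ ≤ G)
    {z w : Cn n} (hz : z ∈ D) (hzp : z ∈ Metric.ball p ρ) (hw : w ∈ D)
    (hwp : w ∈ Metric.ball p ρ) {τ : ℝ} (hτ : 0 < τ) (hτρ : τ ≤ ρ / 2)
    (h1 : ‖w - z‖ / τ + Λ * ‖w - z‖ < ρ)
    (h2 : (‖herm (g z) (w - z)‖ / τ + G * (Λ * ‖w - z‖)) ^ 2 ≤ c * -s z) :
    kobayashi D z w ≤ ENNReal.ofReal (4 * τ / ρ) := by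
  have hρ := H.ρ_pos
  have hsw : s w < 0 := (h.mem_iff w (Metric.ball_subset_ball H.ρ_le hwp)).1 hw
  set V : Cn n := (τ : ℂ)⁻¹ • (w - z) + (T w - T z) with hV
  have hlip : ‖T w - T z‖ ≤ Λ * ‖w - z‖ := H.lip w hwp z hzp
  have hτn : ‖(τ : ℂ)⁻¹‖ = τ⁻¹ := by rw [norm_inv, Complex.norm_real, Real.norm_of_nonneg hτ.le]
  have hVn : ‖V‖ < ρ := by
    refine lt_of_le_of_lt ((norm_add_le _ _).trans (add_le_add ?_ hlip)) h1
    rw [norm_smul, hτn, inv_mul_eq_div]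
  have hVa : ‖herm (g z) V‖ ^ 2 ≤ c * -s z := by
    refine le_trans (pow_le_pow_left₀ (norm_nonneg _) ?_ 2) h2
    rw [hV, herm_add, herm_smul]
    refine (norm_add_le _ _).trans (add_le_add ?_ ?_)
    · rw [norm_mul, hτn, inv_mul_eq_div]
    · refine (norm_herm_le _ _).trans ?_
      have := hG z hzp
      have := (norm_nonneg (g z)).trans this
      gcongr
  obtain ⟨m1, k1⟩ := H.kobayashi_le h hz hzp hVn hVa hτ.le hτρ
  obtain ⟨m2, k2⟩ := H.kobayashi_le h hw hwp (V := 0) (by simpa using hρ)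
    (by
      have : 0 ≤ c * -s w := mul_nonneg H.c_pos.le (by linarith)
      simpa [herm] using this) hτ.le hτρ
  have heq : w + (τ : ℂ) • (T w + 0 + (τ : ℂ) • Y) = z + (τ : ℂ) • (T z + V + (τ : ℂ) • Y) := by
    have hτc : (τ : ℂ) ≠ 0 := by exact_mod_cast hτ.ne'
    have : (τ : ℂ) • V = (w - z) + (τ : ℂ) • (T w - T z) := by
      rw [hV, smul_add, smul_smul, mul_inv_cancel₀ hτc, one_smul]
    rw [smul_add, smul_add, smul_add (τ : ℂ) (T z + V), smul_add (τ : ℂ) (T z), this, smul_sub,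
      smul_zero]
    abel
  rw [heq] at m2 k2
  calc kobayashi D z w ≤ _ + _ := kobayashi_triangle hz m1 hw
    _ ≤ ENNReal.ofReal (2 * τ / ρ) + ENNReal.ofReal (2 * τ / ρ) :=
      add_le_add k1 ((kobayashi_symm_le m1 hw).trans k2)
    _ = _ := by
      rw [← ENNReal.ofReal_add (by positivity) (by positivity)]; congr 1; ring

/-- An estimate between points whose distance is dominated by the square root of the depth. -/
theorem exists_kobayashi_le (H : DiscField p s g T Y r c ρ Λ)
    (h : LocalDefining D p s g r L m) (hG : ∀ z ∈ Metric.ball p ρ, ‖g z‖ ≤ G)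
    {e : ℝ} (he : 0 < e) :
    ∃ C K η₀ : ℝ, 0 < C ∧ 0 < K ∧ 0 < η₀ ∧ ∀ z ∈ D, z ∈ Metric.ball p ρ → ∀ w ∈ D,
      w ∈ Metric.ball p ρ → ∀ σ : ℝ, 0 < σ → e ^ 2 * σ ^ 2 ≤ c * -s z → K * ‖w - z‖ ≤ σ →
      ‖w - z‖ ≤ η₀ → ‖herm (g z) (w - z)‖ ≤ η₀ * σ →
      kobayashi D z w ≤ ENNReal.ofReal (C * (‖w - z‖ + ‖herm (g z) (w - z)‖ / σ)) := by
  have hρ := H.ρ_pos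
  have hΛ := H.Λ_nonneg
  have hG0 : 0 ≤ G := (norm_nonneg _).trans (hG p (Metric.mem_ball_self hρ))
  set P := 4 / ρ + 2 / e with hP
  have hP0 : 0 < P := by positivity
  refine ⟨4 / ρ * P, 2 * G * Λ / e + 1, min (ρ / (2 * (Λ + 1))) (ρ / (4 * P)), by positivity,
    by positivity, by positivity, ?_⟩
  intro z hz hzp w hw hwp σ hσ hs hK ht ha
  set t := ‖w - z‖ with htdef
  set a := ‖herm (g z) (w - z)‖ with hadef
  have ht0 : 0 ≤ t := norm_nonneg _
  have ha0 : 0 ≤ a := norm_nonneg _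
  rcases ht0.eq_or_lt with h0 | hpos
  · have : w = z := sub_eq_zero.1 (norm_eq_zero.1 h0.symm)
    rw [this, kobayashi_self hz]; exact zero_le
  have ht1 : t ≤ ρ / (2 * (Λ + 1)) := ht.trans (min_le_left _ _)
  have ht2 : t ≤ ρ / (4 * P) := ht.trans (min_le_right _ _)
  have ha2 : a / σ ≤ ρ / (4 * P) := by
    rw [div_le_iff₀ hσ]
    refine ha.trans ?_
    gcongr; exact min_le_right _ _
  -- The first term gives t/τ ≤ ρ/4, which keeps the tilt small. The second gives a/τ ≤ eσ/2, half
  -- of the permitted normal component; the other half is left for the variation of T.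
  set τ := 4 / ρ * t + 2 / e * (a / σ) with hτ
  have hτ0 : 0 < τ := by positivity
  have hτP : τ ≤ P * (t + a / σ) := by
    have i1 : 0 ≤ 2 / e * t := by positivity
    have i2 : 0 ≤ 4 / ρ * (a / σ) := by positivity
    rw [hτ, hP]; linarith
  have hτρ : τ ≤ ρ / 2 := by
    refine hτP.trans ?_
    calc P * (t + a / σ) ≤ P * (ρ / (4 * P) + ρ / (4 * P)) := by gcongr
      _ = _ := by field_simp; norm_num
  have key := H.kobayashi_le_of_two_discs h hG hz hzp hw hwp hτ0 hτρ
    (by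
      have i1 : t / τ ≤ ρ / 4 := by
        rw [div_le_iff₀ hτ0, hτ]
        have : 0 ≤ ρ / 4 * (2 / e * (a / σ)) := by positivity
        have : ρ / 4 * (4 / ρ * t) = t := by field_simp
        linarith
      have i2 : Λ * t ≤ ρ / 2 := by
        rw [le_div_iff₀ (by positivity)] at ht1
        nlinarith
      linarith)
    (by
      refine le_trans ?_ hs
      rw [← mul_pow]
      refine pow_le_pow_left₀ (by positivity) ?_ 2
      have i1 : a / τ ≤ e / 2 * σ := by
        rw [div_le_iff₀ hτ0, hτ]
        have : 0 ≤ e / 2 * σ * (4 / ρ * t) := by positivity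
        have : e / 2 * σ * (2 / e * (a / σ)) = a := by field_simp
        linarith
      have i2 : G * (Λ * t) ≤ e / 2 * σ := by
        have : e / 2 * ((2 * G * Λ / e + 1) * t) ≤ e / 2 * σ := by gcongr
        have : e / 2 * ((2 * G * Λ / e + 1) * t) = G * (Λ * t) + e / 2 * t := by field_simp
        have : 0 ≤ e / 2 * t := by positivity
        linarith
      linarith)
  refine key.trans (ENNReal.ofReal_le_ofReal ?_)
  calc 4 * τ / ρ = 4 / ρ * τ := by ring
    _ ≤ 4 / ρ * (P * (t + a / σ)) := by gcongr
    _ = _ := by ring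

end DiscField

theorem IsC2DefiningAt.exists_discField {n : ℕ} {D : Set (Cn n)} {p : Cn n} {s : Cn n → ℝ}
    {r L m : ℝ} (hs : IsC2DefiningAt D p s) (h : LocalDefining D p s (gradient s) r L m) {X : Cn n}
    (hX : fderiv ℝ s p X = 0) (hIX : fderiv ℝ s p (Complex.I • X) = 0)
    (hneg : leviForm s p X < 0) :
    ∃ T Y c ρ Λ, DiscField p s (gradient s) T Y r c ρ Λ := by
  obtain ⟨N, Y, c, ρ, hc, hρ, H⟩ := exists_disc_estimate hs hX hIX hneg h.r_pos
  have hL := h.L_pos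
  refine ⟨fun z => tangentField X N (gradient s z), Y, c, min ρ r, 2 * ‖X‖ * ‖N‖ * L, hc,
    lt_min hρ h.r_pos, min_le_right _ _, by positivity, ?_, ?_⟩
  · intro z hz w hw
    have := h.lip w (Metric.ball_subset_ball (min_le_right _ _) hw) z
      (Metric.ball_subset_ball (min_le_right _ _) hz)
    refine (norm_tangentField_sub_le _ _ _ _).trans ?_
    rw [mul_assoc _ L]
    gcongr
  · intro z hz V hV ζ hζ
    exact H z (Metric.ball_subset_ball (min_le_left _ _) hz) V (hV.trans_le (min_le_left _ _)) ζ
      (hζ.trans_le (min_le_left _ _))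

/-! ### Upper bound: deep and shallow points. -/

section UpperBound

variable {n : ℕ} {D : Set (Cn n)} {p : Cn n} {s : Cn n → ℝ} {g T : Cn n → Cn n} {Y : Cn n}
  {r L m c ρ ρ' Λ G : ℝ}

theorem LocalDefining.norm_normalComp_le (h : LocalDefining D p s g r L m) (hD : IsOpen D)
    (hp : p ∈ frontier D) (hρ : 2 * ρ ≤ r) (hρm : 4 * L * ρ ≤ m) {z : Cn n}
    (hz : z ∈ D) (hzp : z ∈ Metric.ball p ρ) (v : Cn n) : ‖normalComp D z v‖ ≤ ‖v‖ := by
  obtain ⟨q, hq, hd⟩ := LocalDefining.exists_nearest hp z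
  have hqr := LocalDefining.nearest_mem_ball hp hρ hzp hd
  rw [normalComp_eq_herm, h.gradient_bdist hD hp hρ hρm hz hzp hq hd]
  refine (norm_herm_le _ _).trans_eq ?_
  rw [norm_neg, norm_unitVec (h.m_pos.trans_le (h.lower q hqr)), one_mul]

/-- For deep points the denominator √A + t + σ is at most 2σ. -/
theorem div_sqrt_le_gauge {A t σ : ℝ} (hA : 0 ≤ A) (ht : 0 ≤ t) (hσ : 0 < σ)
    (h : √A + t ≤ σ) : A / σ + t ≤ 2 * (A / (√A + t + σ) + t) := by
  have h0 := Real.sqrt_nonneg A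
  have h1 : A / σ ≤ 2 * (A / (√A + t + σ)) := by
    rw [← mul_div_assoc, div_le_div_iff₀ hσ (by positivity)]
    nlinarith
  linarith

/-- For shallow points, if √A ≤ t the summand t suffices. Otherwise the denominator is at most
2(1+K)√A, and the quotient is comparable to √A. -/
theorem sqrt_add_le_gauge {A t σ K : ℝ} (hA : 0 ≤ A) (ht : 0 ≤ t) (hK : 0 < K) (hσ : 0 ≤ σ)
    (h : σ ≤ K * (√A + t)) : √A + t ≤ 2 * (1 + K) * (A / (√A + t + σ) + t) := by
  have h0 := Real.sqrt_nonneg A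
  have hdiv : 0 ≤ A / (√A + t + σ) := by positivity
  rcases le_or_gt (√A) t with hle | hgt
  · nlinarith [mul_nonneg hK.le hdiv, mul_nonneg hK.le ht]
  · have hA1 : 0 < √A := ht.trans_lt hgt
    have hden : √A + t + σ ≤ 2 * (1 + K) * √A := by nlinarith
    have h1 : √A / (2 * (1 + K)) ≤ A / (√A + t + σ) := by
      rw [div_le_div_iff₀ (by positivity) (by positivity)]
      calc √A * (√A + t + σ) ≤ √A * (2 * (1 + K) * √A) := by gcongr
        _ = (√A * √A) * (2 * (1 + K)) := by ring
        _ = A * (2 * (1 + K)) := by rw [Real.mul_self_sqrt hA]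
    rw [div_le_iff₀ (by positivity)] at h1
    have := mul_nonneg hK.le ht
    linarith

namespace DiscField

theorem norm_gradient_le (H : DiscField p s g T Y r c ρ Λ) (h : LocalDefining D p s g r L m) :
    ∀ z ∈ Metric.ball p ρ, ‖g z‖ ≤ ‖g p‖ + L * r := by
  intro z hz
  have hzr := Metric.ball_subset_ball H.ρ_le hz
  have h1 := h.lip p (Metric.mem_ball_self h.r_pos) z hzr
  have h3 : ‖g z‖ ≤ ‖g p‖ + ‖g z - g p‖ := norm_le_norm_add_norm_sub' _ _
  have h4 : ‖z - p‖ ≤ r := by rw [← dist_eq_norm]; exact (Metric.mem_ball.1 hzr).le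
  have h5 := mul_le_mul_of_nonneg_left h4 h.L_pos.le
  linarith

theorem norm_direction_le (H : DiscField p s g T Y r c ρ Λ) :
    ∀ z ∈ Metric.ball p ρ, ‖T z‖ ≤ ‖T p‖ + Λ * ρ := by
  intro z hz
  have h1 := H.lip z hz p (Metric.mem_ball_self H.ρ_pos)
  have h3 : ‖T z‖ ≤ ‖T p‖ + ‖T z - T p‖ := norm_le_norm_add_norm_sub' _ _
  have h4 : ‖z - p‖ ≤ ρ := by rw [← dist_eq_norm]; exact (Metric.mem_ball.1 hz).le
  have h5 := mul_le_mul_of_nonneg_left h4 H.Λ_nonneg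
  linarith

/-- Moving a point of `D` into the domain along the quadratic disc through it. -/
theorem kobayashi_push (H : DiscField p s g T Y r c ρ Λ) (h : LocalDefining D p s g r L m)
    {x : Cn n} (hx : x ∈ D) (hxp : x ∈ Metric.ball p ρ') (hρρ : 2 * ρ' ≤ ρ) {η : ℝ} (hη : 0 ≤ η)
    (hη1 : η ≤ 1) (hηρ : η ≤ ρ / 2) (hJη : (‖T p‖ + Λ * ρ + ‖Y‖) * η ≤ ρ / 2) :
    x + (η : ℂ) • (T x + 0 + (η : ℂ) • Y) ∈ D ∧
    kobayashi D x (x + (η : ℂ) • (T x + 0 + (η : ℂ) • Y)) ≤ ENNReal.ofReal (2 * η / ρ) ∧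
    x + (η : ℂ) • (T x + 0 + (η : ℂ) • Y) ∈ Metric.ball p ρ ∧
    ‖x + (η : ℂ) • (T x + 0 + (η : ℂ) • Y) - x‖ ≤ (‖T p‖ + Λ * ρ + ‖Y‖) * η := by
  have hρ := H.ρ_pos
  have hηn : ‖(η : ℂ)‖ = η := by rw [Complex.norm_real, Real.norm_of_nonneg hη]
  have hxρ := Metric.ball_subset_ball (show ρ' ≤ ρ by linarith) hxp
  have hsx : s x < 0 := (h.mem_iff x (Metric.ball_subset_ball H.ρ_le hxρ)).1 hx
  obtain ⟨h1, h2⟩ := H.kobayashi_le h hx hxρ (V := 0) (by simpa using hρ)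
    (by
      have : 0 ≤ c * -s x := mul_nonneg H.c_pos.le (by linarith)
      simpa [herm] using this) hη hηρ
  have h3 : ‖x + (η : ℂ) • (T x + 0 + (η : ℂ) • Y) - x‖ ≤ (‖T p‖ + Λ * ρ + ‖Y‖) * η := by
    rw [add_sub_cancel_left, norm_smul, hηn, add_zero, mul_comm]
    gcongr
    refine (norm_add_le _ _).trans (add_le_add (H.norm_direction_le x hxρ) ?_)
    rw [norm_smul, hηn]
    exact mul_le_of_le_one_left (norm_nonneg _) hη1
  refine ⟨h1, h2, ?_, h3⟩
  rw [← dist_eq_norm] at h3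
  have h4 := dist_triangle (x + (η : ℂ) • (T x + 0 + (η : ℂ) • Y)) x p
  rw [Metric.mem_ball] at hxp ⊢
  linarith

/-- The estimate from above for points deep in the domain compared with their distance. -/
theorem exists_kobayashi_le_HD_of_deep (H : DiscField p s g T Y r c ρ Λ)
    (h : LocalDefining D p s g r L m) (hD : IsOpen D) (hp : p ∈ frontier D) (hρr : 2 * ρ' ≤ r)
    (hρm : 4 * L * ρ' ≤ m) (hρρ : ρ' ≤ ρ) (hρ1 : ρ' ≤ 1) :
    ∃ C K ω : ℝ, 0 < C ∧ 0 < K ∧ 0 < ω ∧ ∀ z ∈ D, z ∈ Metric.ball p ρ' → ∀ w ∈ D,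
      w ∈ Metric.ball p ρ' → √‖normalComp D z (z - w)‖ + ‖z - w‖ ≤ ω →
      K * (√‖normalComp D z (z - w)‖ + ‖z - w‖) ≤ √(bdist D z) →
      kobayashi D z w ≤ ENNReal.ofReal (C * HD D z w) := by
  have hm := h.m_pos
  have hL := h.L_pos
  have hr := h.r_pos
  have hc := H.c_pos
  have hG := H.norm_gradient_le h
  set G := ‖g p‖ + L * r with hGdef
  have hG0 : 0 < G := by positivity
  -- With σ = √δ, this e turns the depth condition into (m/2)δ ≤ -s(z), which is `le_neg_bdist`.
  obtain ⟨C, K, η₀, hC, hK, hη₀, hmain⟩ := H.exists_kobayashi_le h hG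
    (e := √(c * (m / 2))) (by positivity)
  refine ⟨2 * C * (1 + G + L), K + 1, min η₀ (η₀ / (G + L)), by positivity, by positivity,
    by positivity, ?_⟩
  intro z hz hzp w hw hwp hω hdeep
  have hzρ := Metric.ball_subset_ball hρρ hzp
  have hwρ := Metric.ball_subset_ball hρρ hwp
  have hδ0 := LocalDefining.bdist_pos hD hp hz
  have hδ1 := (LocalDefining.bdist_lt hp hzp).le.trans hρ1
  have hA := h.norm_herm_le_normalComp hD hp hρr hρm hz hzp (z - w)
  have hneg : ‖herm (g z) (w - z)‖ = ‖herm (g z) (z - w)‖ := by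
    rw [← neg_sub z w, herm_neg, norm_neg]
  have hs := h.le_neg_bdist hD hp hρr hρm hz hzp
  have hHD : HD D z w = ‖normalComp D z (z - w)‖ /
    (√‖normalComp D z (z - w)‖ + ‖z - w‖ + √(bdist D z)) + ‖z - w‖ := rfl
  rw [← hneg] at hA
  set A := ‖normalComp D z (z - w)‖
  set t := ‖z - w‖
  set δ := bdist D z
  have ht : ‖w - z‖ = t := norm_sub_rev _ _
  have hA0 : 0 ≤ A := norm_nonneg _
  have ht0 : 0 ≤ t := norm_nonneg _
  have hsA := Real.sqrt_nonneg A
  have hσ : 0 < √δ := Real.sqrt_pos.2 hδ0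
  have hσ1 : √δ ≤ 1 := Real.sqrt_le_one.2 hδ1
  have hsqδ : √δ * √δ = δ := Real.mul_self_sqrt hδ0.le
  have hsqA : √A * √A = A := Real.mul_self_sqrt hA0
  have hKs := mul_nonneg hK.le (add_nonneg hsA ht0)
  have hAt : √A + t ≤ √δ := by linarith
  have ha : ‖herm (g z) (w - z)‖ / √δ ≤ G * (A / √δ) + L * t := by
    rw [div_le_iff₀ hσ]
    have e1 : (G * (A / √δ) + L * t) * √δ = G * A + L * √δ * t := by field_simp
    have e2 : L * δ * t ≤ L * √δ * t := by gcongr; exact hsqδ.symm.trans_le (mul_le_of_le_one_left hσ.le hσ1)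
    linarith
  have hAσ : A / √δ ≤ √A := by
    rw [div_le_iff₀ hσ]
    calc A = √A * √A := hsqA.symm
      _ ≤ √A * √δ := mul_le_mul_of_nonneg_left (by linarith) hsA
  have hω1 : (G + L) * (√A + t) ≤ η₀ := by
    have := hω.trans (min_le_right _ _)
    rwa [le_div_iff₀ (by positivity), mul_comm] at this
  have hk := hmain z hz hzρ w hw hwρ (√δ) hσ
    (by
      rw [Real.sq_sqrt (by positivity), Real.sq_sqrt hδ0.le, mul_assoc]
      gcongr; linarith)
    (by
      rw [ht]
      have := mul_nonneg hK.le hsA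
      linarith)
    (by rw [ht]; linarith [hω.trans (min_le_left _ _)])
    (by
      rw [← div_le_iff₀ hσ]
      have : G * (A / √δ) ≤ G * √A := by gcongr
      have := mul_nonneg hL.le hsA
      have := mul_nonneg hG0.le ht0
      linarith)
  refine hk.trans (ENNReal.ofReal_le_ofReal ?_)
  have hg := div_sqrt_le_gauge hA0 ht0 hσ hAt
  rw [← hHD] at hg
  rw [ht]
  have hdiv : 0 ≤ A / √δ := by positivity
  calc C * (t + ‖herm (g z) (w - z)‖ / √δ) ≤ C * (t + (G * (A / √δ) + L * t)) := by gcongr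
    _ ≤ C * ((1 + G + L) * (A / √δ + t)) := by
      gcongr
      have := mul_nonneg hL.le hdiv
      have := mul_nonneg hG0.le ht0
      linarith
    _ ≤ C * ((1 + G + L) * (2 * HD D z w)) := by gcongr
    _ = _ := by ring

/-- The displacement between two points moved into the domain along quadratic discs. -/
theorem norm_push_sub_le (H : DiscField p s g T Y r c ρ Λ) (h : LocalDefining D p s g r L m)
    (hG : ∀ z ∈ Metric.ball p ρ, ‖g z‖ ≤ G) {z w z' w' : Cn n} {η J t : ℝ}
    (hz : z ∈ Metric.ball p ρ) (hw : w ∈ Metric.ball p ρ) (hz' : z' ∈ Metric.ball p ρ)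
    (hη : 0 < η) (hη1 : η ≤ 1)
    (hz'e : z' = z + (η : ℂ) • (T z + 0 + (η : ℂ) • Y))
    (hw'e : w' = w + (η : ℂ) • (T w + 0 + (η : ℂ) • Y)) (hJ : ‖z' - z‖ ≤ J * η)
    (ht : ‖w - z‖ = t) (htη : t ≤ η) (ha : ‖herm (g z) (w - z)‖ ≤ G * η ^ 2 + L * η ^ 2) :
    ‖w' - z'‖ ≤ (1 + Λ) * t ∧
    ‖herm (g z') (w' - z')‖ ≤ (G + L + G * Λ + L * J * (1 + Λ)) * η ^ 2 := by
  have hL := h.L_pos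
  have hΛ := H.Λ_nonneg
  have hG0 : 0 ≤ G := (norm_nonneg _).trans (hG z hz)
  have ht0 : 0 ≤ t := ht ▸ norm_nonneg _
  have hηn : ‖(η : ℂ)‖ = η := by rw [Complex.norm_real, Real.norm_of_nonneg hη.le]
  have hdiff : w' - z' = (w - z) + (η : ℂ) • (T w - T z) := by
    rw [hz'e, hw'e, smul_add, smul_add, smul_add, smul_add, smul_sub]; abel
  have hTl : ‖(η : ℂ) • (T w - T z)‖ ≤ η * (Λ * t) := by
    rw [norm_smul, hηn, ← ht]
    exact mul_le_mul_of_nonneg_left (H.lip w hw z hz) hη.le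
  have ht' : ‖w' - z'‖ ≤ (1 + Λ) * t := by
    rw [hdiff]
    refine (norm_add_le _ _).trans ?_
    rw [ht]
    have : η * (Λ * t) ≤ 1 * (Λ * t) := mul_le_mul_of_nonneg_right hη1 (by positivity)
    linarith
  refine ⟨ht', ?_⟩
  -- All three parts are O(η²): a gradient change O(η) against a displacement O(η), the original
  -- normal component, and η times the change O(η) of T.
  have i1 : herm (g z') (w' - z') = herm (g z' - g z) (w' - z') + (herm (g z) (w - z) +
      herm (g z) ((η : ℂ) • (T w - T z))) := by
    rw [← herm_add, ← hdiff, herm_sub_left]; ring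
  have i2 : ‖herm (g z' - g z) (w' - z')‖ ≤ L * (J * η) * ((1 + Λ) * η) := by
    have j1 := h.lip z (Metric.ball_subset_ball H.ρ_le hz) z' (Metric.ball_subset_ball H.ρ_le hz')
    have j2 := j1.trans (mul_le_mul_of_nonneg_left hJ hL.le)
    have j3 : (1 + Λ) * t ≤ (1 + Λ) * η := mul_le_mul_of_nonneg_left htη (by linarith)
    exact (norm_herm_le _ _).trans
      (mul_le_mul j2 (ht'.trans j3) (norm_nonneg _) ((norm_nonneg _).trans j2))
  have i3 : ‖herm (g z) ((η : ℂ) • (T w - T z))‖ ≤ G * (η * (Λ * η)) := by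
    have j1 : η * (Λ * t) ≤ η * (Λ * η) := by gcongr
    exact (norm_herm_le _ _).trans
      (mul_le_mul (hG z hz) (hTl.trans j1) (norm_nonneg _) hG0)
  rw [i1]
  refine (norm_add_le _ _).trans ?_
  have i5 := norm_add_le (herm (g z) (w - z)) (herm (g z) ((η : ℂ) • (T w - T z)))
  have i6 : (G + L + G * Λ + L * J * (1 + Λ)) * η ^ 2 = L * (J * η) * ((1 + Λ) * η) +
      (G * η ^ 2 + L * η ^ 2 + G * (η * (Λ * η))) := by ring
  linarith

set_option maxHeartbeats 800000 in
/-- The estimate from above for points close to the boundary compared with their distance: first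
move both points into the domain along quadratic discs. -/
theorem exists_kobayashi_le_of_shallow (H : DiscField p s g T Y r c ρ Λ)
    (h : LocalDefining D p s g r L m) (hD : IsOpen D) (hp : p ∈ frontier D) (hρr : 2 * ρ' ≤ r)
    (hρm : 4 * L * ρ' ≤ m) (hρρ : 2 * ρ' ≤ ρ) (hρ0 : 0 < ρ') :
    ∃ C K ω : ℝ, 0 < C ∧ 0 < K ∧ 0 < ω ∧ ∀ z ∈ D, z ∈ Metric.ball p ρ' → ∀ w ∈ D,
      w ∈ Metric.ball p ρ' → ∀ η : ℝ, 0 < η → η ≤ ω →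
      K * (√‖normalComp D z (z - w)‖ + ‖z - w‖) ≤ η → √(bdist D z) ≤ η →
      kobayashi D z w ≤ ENNReal.ofReal (C * η) := by
  have hm := h.m_pos
  have hL := h.L_pos
  have hr := h.r_pos
  have hc := H.c_pos
  have hρ := H.ρ_pos
  have hΛ := H.Λ_nonneg
  have hG := H.norm_gradient_le h
  set G := ‖g p‖ + L * r with hGdef
  have hG0 : 0 < G := by positivity
  set J := ‖T p‖ + Λ * ρ + ‖Y‖ with hJ
  have hJ0 : 0 ≤ J := by positivity
  -- The pushed point z' satisfies -s(z') ≥ cη², so with σ = η the depth condition holds for e = c.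
  obtain ⟨C, K, η₀, hC, hK, hη₀, hmain⟩ := H.exists_kobayashi_le h hG (e := c) hc
  set Q := G + L + G * Λ + L * J * (1 + Λ) with hQ
  have hQ0 : 0 < Q := by positivity
  set P := 1 + J + Λ + Q with hP
  have hP0 : 0 < P := by positivity
  refine ⟨4 / ρ + C * (1 + Λ + Q), 1 + K * (1 + Λ), min 1 (min ρ η₀ / (4 * P)), by positivity,
    by positivity, by positivity, ?_⟩
  intro z hz hzp w hw hwp η hη hηω hKη hδη
  have hzρ := Metric.ball_subset_ball (show ρ' ≤ ρ by linarith) hzp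
  have hwρ := Metric.ball_subset_ball (show ρ' ≤ ρ by linarith) hwp
  have hδ0 := LocalDefining.bdist_pos hD hp hz
  have hA := h.norm_herm_le_normalComp hD hp hρr hρm hz hzp (z - w)
  have hneg : ‖herm (g z) (w - z)‖ = ‖herm (g z) (z - w)‖ := by
    rw [← neg_sub z w, herm_neg, norm_neg]
  rw [← hneg] at hA
  have ht : ‖w - z‖ = ‖z - w‖ := norm_sub_rev _ _
  have hA0 : 0 ≤ ‖normalComp D z (z - w)‖ := norm_nonneg _
  have ht0 : 0 ≤ ‖z - w‖ := norm_nonneg _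
  generalize ‖normalComp D z (z - w)‖ = A at hA hA0 hKη
  generalize ‖z - w‖ = t at hA hKη ht ht0
  generalize bdist D z = δ at hA hδη hδ0
  have hsA := Real.sqrt_nonneg A
  have hη1 : η ≤ 1 := hηω.trans (min_le_left _ _)
  have hηP : P * η ≤ min ρ η₀ / 4 := by
    have := hηω.trans (min_le_right _ _)
    rw [le_div_iff₀ (by positivity)] at this
    linarith
  have hηρ : P * η ≤ ρ / 4 := hηP.trans (by gcongr; exact min_le_left _ _)
  have hηη₀ : P * η ≤ η₀ / 4 := hηP.trans (by gcongr; exact min_le_right _ _)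
  have e1 : η ≤ P * η := le_mul_of_one_le_left hη.le (by rw [hP]; linarith)
  have e2 : J * η ≤ P * η := by gcongr; rw [hP]; linarith
  have e3 : (1 + Λ) * η ≤ P * η := by gcongr; rw [hP]; linarith
  have e4 : Q * η ≤ P * η := by gcongr; rw [hP]; linarith
  have hKΛ : 0 ≤ K * (1 + Λ) := by positivity
  have hKs := mul_nonneg hKΛ hsA
  have hKt' := mul_nonneg hKΛ ht0
  have hsum : √A + t ≤ η := by linarith
  have hKt : K * ((1 + Λ) * t) ≤ η := by linarith
  have htη : t ≤ η := by linarith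
  have hAη : A ≤ η ^ 2 := Real.sqrt_le_left hη.le |>.1 (by linarith)
  have hδη' : δ ≤ η ^ 2 := Real.sqrt_le_left hη.le |>.1 hδη
  have hs : s z < 0 := (h.mem_iff z (Metric.ball_subset_ball H.ρ_le hzρ)).1 hz
  have hηn : ‖(η : ℂ)‖ = η := by rw [Complex.norm_real, Real.norm_of_nonneg hη.le]
  obtain ⟨hz1, kz, hz2, hz3⟩ := H.kobayashi_push h hz hzp hρρ hη.le hη1 (by linarith)
    (show J * η ≤ ρ / 2 by linarith)
  obtain ⟨hw1, kw, hw2, -⟩ := H.kobayashi_push h hw hwp hρρ hη.le hη1 (by linarith)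
    (show J * η ≤ ρ / 2 by linarith)
  have hdeep := (H.disc z hzρ 0 (by simpa using hρ) η (by rw [hηn]; linarith)).2
  have hh0 : ‖herm (g z) 0‖ = 0 := by simp [herm]
  rw [hηn, hh0, mul_zero, add_zero (s z)] at hdeep
  have ha : ‖herm (g z) (w - z)‖ ≤ G * η ^ 2 + L * η ^ 2 := by
    refine hA.trans (add_le_add (mul_le_mul_of_nonneg_left hAη hG0.le) ?_)
    calc L * δ * t ≤ L * η ^ 2 * 1 :=
          mul_le_mul (mul_le_mul_of_nonneg_left hδη' hL.le) (htη.trans hη1) ht0 (by positivity)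
      _ = _ := mul_one _
  obtain ⟨ht', ha'⟩ := H.norm_push_sub_le h hG hzρ hwρ hz2 hη hη1 rfl rfl hz3 ht htη ha
  generalize z + (η : ℂ) • (T z + 0 + (η : ℂ) • Y) = z' at hz1 kz hz2 hdeep ht' ha' ⊢
  generalize w + (η : ℂ) • (T w + 0 + (η : ℂ) • Y) = w' at hw1 kw hw2 ht' ha' ⊢
  have hk := hmain z' hz1 hz2 w' hw1 hw2 η hη
    (by
      rw [pow_two c, mul_assoc]
      exact mul_le_mul_of_nonneg_left (by linarith) hc.le)
    ((mul_le_mul_of_nonneg_left ht' hK.le).trans hKt)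
    (by
      have : (1 + Λ) * t ≤ (1 + Λ) * η := by gcongr
      linarith)
    (by
      refine ha'.trans ?_
      rw [pow_two, ← mul_assoc]
      exact mul_le_mul_of_nonneg_right (by linarith) hη.le)
  have hk' : kobayashi D z' w' ≤ ENNReal.ofReal (C * (1 + Λ + Q) * η) := by
    refine hk.trans (ENNReal.ofReal_le_ofReal ?_)
    have j1 : ‖herm (g z') (w' - z')‖ / η ≤ Q * η := by
      rw [div_le_iff₀ hη]; linarith
    have j2 : ‖w' - z'‖ ≤ (1 + Λ) * η := ht'.trans (by gcongr)
    rw [mul_assoc, add_mul]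
    gcongr
  calc kobayashi D z w ≤ kobayashi D z z' + kobayashi D z' w := kobayashi_triangle hz hz1 hw
    _ ≤ kobayashi D z z' + (kobayashi D z' w' + kobayashi D w' w) := by
      gcongr; exact kobayashi_triangle hz1 hw1 hw
    _ ≤ ENNReal.ofReal (2 * η / ρ) + (ENNReal.ofReal (C * (1 + Λ + Q) * η) +
        ENNReal.ofReal (2 * η / ρ)) := by
      gcongr
      exact (kobayashi_symm_le hw1 hw).trans kw
    _ = _ := by
      rw [← ENNReal.ofReal_add (by positivity) (by positivity),
        ← ENNReal.ofReal_add (by positivity) (by positivity)]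
      congr 1; ring

/-- The upper estimate of the Kobayashi pseudodistance. -/
theorem exists_kobayashi_le_HD (H : DiscField p s g T Y r c ρ Λ)
    (h : LocalDefining D p s g r L m) (hD : IsOpen D) (hp : p ∈ frontier D) (hρr : 2 * ρ' ≤ r)
    (hρm : 4 * L * ρ' ≤ m) (hρρ : 2 * ρ' ≤ ρ) (hρ1 : ρ' ≤ 1) (hρ0 : 0 < ρ') :
    ∃ ε > 0, ∃ C : ℝ, 0 < C ∧ ∀ z ∈ D ∩ Metric.ball p ε, ∀ w ∈ D ∩ Metric.ball p ε,
      kobayashi D z w ≤ ENNReal.ofReal (C * HD D z w) := by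
  obtain ⟨C₁, K₁, ω₁, hC₁, hK₁, hω₁, H₁⟩ :=
    H.exists_kobayashi_le_HD_of_deep h hD hp hρr hρm (by linarith) hρ1
  obtain ⟨C₂, K₂, ω₂, hC₂, hK₂, hω₂, H₂⟩ :=
    H.exists_kobayashi_le_of_shallow h hD hp hρr hρm hρρ hρ0
  set K := K₁ + K₂ with hK
  have hK0 : 0 < K := by positivity
  set ω := min ω₁ (ω₂ / K) with hω
  have hω0 : 0 < ω := by positivity
  obtain ⟨ε, hε0, hε⟩ : ∃ ε > 0, √(2 * ε) + 2 * ε < ω := by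
    have hcont : Continuous fun ε : ℝ => √(2 * ε) + 2 * ε := by fun_prop
    have := (hcont.tendsto 0).eventually_lt_const (u := ω) (by simpa using hω0)
    have hev : ∀ᶠ ε : ℝ in 𝓝[>] 0, √(2 * ε) + 2 * ε < ω := nhdsWithin_le_nhds this
    obtain ⟨ε, h1, h2⟩ := (hev.and self_mem_nhdsWithin).exists
    exact ⟨ε, h2, h1⟩
  refine ⟨min ε ρ', lt_min hε0 hρ0, C₁ + C₂ * K * (2 * (1 + K)), by positivity, ?_⟩
  rintro z ⟨hz, hzε⟩ w ⟨hw, hwε⟩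
  have hzp := Metric.ball_subset_ball (min_le_right _ _) hzε
  have hwp := Metric.ball_subset_ball (min_le_right _ _) hwε
  have hzε := Metric.ball_subset_ball (min_le_left _ _) hzε
  have hwε := Metric.ball_subset_ball (min_le_left _ _) hwε
  have hAt := h.norm_normalComp_le hD hp hρr hρm hz hzp (z - w)
  have htε : ‖z - w‖ ≤ 2 * ε := by
    rw [← dist_eq_norm]
    have := dist_triangle_right z w p
    rw [Metric.mem_ball] at hzε hwε
    linarith
  have hsum : √‖normalComp D z (z - w)‖ + ‖z - w‖ ≤ ω := by
    have := Real.sqrt_le_sqrt (hAt.trans htε)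
    linarith
  have hHD0 : 0 ≤ HD D z w := by unfold HD; positivity
  have hs0 : 0 ≤ √‖normalComp D z (z - w)‖ + ‖z - w‖ := by positivity
  -- In the shallow case the push parameter is η = K(√A + t), which then exceeds √δ.
  rcases le_or_gt (K * (√‖normalComp D z (z - w)‖ + ‖z - w‖)) (√(bdist D z)) with hd | hd
  · refine (H₁ z hz hzp w hw hwp (hsum.trans (min_le_left _ _)) (le_trans ?_ hd)).trans
      (ENNReal.ofReal_le_ofReal ?_)
    · gcongr; rw [hK]; linarith
    · gcongr
      exact le_add_of_nonneg_right (by positivity)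
  · refine (H₂ z hz hzp w hw hwp _ ((Real.sqrt_nonneg _).trans_lt hd) ?_ ?_ hd.le).trans
      (ENNReal.ofReal_le_ofReal ?_)
    · have := hsum.trans (min_le_right _ _)
      rw [le_div_iff₀ hK0] at this
      linarith
    · gcongr; rw [hK]; linarith
    · have := sqrt_add_le_gauge (norm_nonneg (normalComp D z (z - w))) (norm_nonneg (z - w)) hK0
        (Real.sqrt_nonneg _) hd.le
      change _ ≤ 2 * (1 + K) * HD D z w at this
      calc C₂ * (K * (√‖normalComp D z (z - w)‖ + ‖z - w‖)) ≤
          C₂ * (K * (2 * (1 + K) * HD D z w)) := by gcongr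
        _ ≤ _ := by nlinarith [mul_nonneg hC₁.le hHD0]

end DiscField

end UpperBound

/-! ### Conclusion on a common neighbourhood. -/

theorem theorem4 {n : ℕ} (D : Set (Cn n)) (hDo : IsOpen D) (hDc : IsConnected D)
    (p : Cn n) (hp : NonSemipositive D p) :
    ∃ U ∈ 𝓝 p,
      (∀ z ∈ D ∩ U, (∃! q, q ∈ frontier D ∧ dist z q = bdist D z) ∧
        DifferentiableAt ℝ (bdist D) z) ∧
      (∃ C : ℝ, 0 < C ∧ ∀ z ∈ D ∩ U, ∀ w ∈ D ∩ U,
        kobayashi D z w ≤ ENNReal.ofReal (C * HD D z w)) ∧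
      (Bornology.IsBounded D → ∃ c : ℝ, 0 < c ∧ ∀ z ∈ D ∩ U, ∀ w ∈ D ∩ U,
        ENNReal.ofReal (c * HD D z w) ≤ kobayashi D z w) ∧
      (∃ C : ℝ, 0 < C ∧ ∀ z ∈ D ∩ U, ∀ w ∈ D ∩ U,
        kobayashi D z w ≤ ENNReal.ofReal (C * (√‖normalComp D z (z - w)‖ + ‖z - w‖))) := by
  obtain ⟨hpf, s, hs, X, hX, hIX, hneg⟩ := hp
  obtain ⟨r, L, m, h⟩ := hs.exists_localDefining
  obtain ⟨T, Y, c, ρ, Λ, H⟩ := hs.exists_discField h hX hIX hneg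
  have hr := h.r_pos
  have hL := h.L_pos
  have hm := h.m_pos
  have hρ := H.ρ_pos
  obtain ⟨ρ', hρ0, hρr, hρm, hρρ, hρ1⟩ : ∃ ρ' : ℝ, 0 < ρ' ∧ 4 * ρ' ≤ r ∧ 4 * L * ρ' ≤ m ∧
      2 * ρ' ≤ ρ ∧ ρ' ≤ 1 := by
    refine ⟨min (min (r / 4) (m / (4 * L))) (min (ρ / 2) 1), by positivity, ?_, ?_, ?_,
      (min_le_right _ _).trans (min_le_right _ _)⟩
    · have := (min_le_left (min (r / 4) (m / (4 * L))) (min (ρ / 2) 1)).trans (min_le_left _ _)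
      linarith
    · have := (min_le_left (min (r / 4) (m / (4 * L))) (min (ρ / 2) 1)).trans (min_le_right _ _)
      rw [le_div_iff₀ (by positivity)] at this
      linarith
    · have := (min_le_right (min (r / 4) (m / (4 * L))) (min (ρ / 2) 1)).trans (min_le_left _ _)
      linarith
  obtain ⟨ε, hε, C, hC, hup⟩ :=
    H.exists_kobayashi_le_HD h hDo hpf (by linarith) hρm hρρ hρ1 hρ0
  have hsub : Metric.ball p (min ε ρ') ⊆ Metric.ball p ε := Metric.ball_subset_ball (min_le_left _ _)
  have hsub' : Metric.ball p (min ε ρ') ⊆ Metric.ball p ρ' :=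
    Metric.ball_subset_ball (min_le_right _ _)
  refine ⟨Metric.ball p (min ε ρ'), Metric.ball_mem_nhds _ (lt_min hε hρ0), ?_, ?_, ?_, ?_⟩
  · rintro z ⟨hz, hzU⟩
    refine ⟨h.existsUnique_nearest hDo hpf (by linarith) hρm hz (hsub' hzU), ?_⟩
    obtain ⟨q, hq, hd⟩ := LocalDefining.exists_nearest hpf z
    exact (h.hasGradientAt_bdist hDo hpf (by linarith) hρm hz (hsub' hzU) hq hd).differentiableAt
  · exact ⟨C, hC, fun z hz w hw => hup z ⟨hz.1, hsub hz.2⟩ w ⟨hw.1, hsub hw.2⟩⟩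
  · intro hb
    obtain ⟨c, hc, hlow⟩ := h.exists_le_kobayashi hDo hpf hρr hρm hρ1 hb
    exact ⟨c, hc, fun z hz w hw => hlow z ⟨hz.1, hsub' hz.2⟩ w ⟨hw.1, hsub' hw.2⟩⟩
  · refine ⟨C, hC, fun z hz w hw => (hup z ⟨hz.1, hsub hz.2⟩ w ⟨hw.1, hsub hw.2⟩).trans
      (ENNReal.ofReal_le_ofReal ?_)⟩
    gcongr
    exact LocalDefining.HD_le D z w
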